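/- Write $S^1=\mathbb R/\mathbb Z$ and $\mathbb T^2=\mathbb R^2/\mathbb Z^2$, let $(\phi,I)$ be the coordinates of $\mathbb R^2$, and let $p:\mathbb R^2\to\mathbb T^2$ be the quotient map. Let $TQ$ be the set of $C^1$ diffeomorphisms $T=(T_\phi,T_I):\mathbb R^2\to\mathbb R^2$ that are lifts of $C^1$ diffeomorphisms of the cylinder $S^1\times\mathbb R$, satisfy $\partial_I T_\phi>0$, satisfy $T_\phi(\phi,I)\to\pm\infty$ and $T_I(\phi,I)\to\pm\infty$ as $I\to\pm\infty$ for every $\phi$, and satisfy $$T(\phi+1,I)=T(\phi,I)+(1,0),\qquad T(\phi,I+1)=T(\phi,I)+(1,1).$$ Such a $T$ induces a map $\widehat T$ of $S^1\times\mathbb R$ and a map $\overline T$ of $\mathbb T^2$. Let $\mu$ be a Borel measure on $S^1\times\mathbb R$ that is finite on compact sets, positive on non-empty open sets and absolutely continuous with respect to Lebesgue measure. The map $\widehat T$ is called $\mu$-exact if $\mu$ is $\widehat T$-invariant and $\mu(\widehat T(A)\setminus A)=\mu(A\setminus\widehat T(A))$ for every open set $A\subset S^1\times\mathbb R$ that is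 homeomorphic to $S^1\times\mathbb R$ and has compact boundary. A rotational invariant circle of $T$ is a homotopically non-trivial simple closed curve $C\subset S^1\times\mathbb R$ with $\widehat T(C)=C$. A periodic orbit $O\subset\mathbb T^2$ of $\overline T$ has vertical rotation number $\omega\in\mathbb R$ if for every $z\in p^{-1}(O)$ the limit $\lim_{n\to\infty}\frac{T^n(z)-z}{n}$ exists in $[-\infty,+\infty]^2$ and equals $(+\infty,\omega)$ or $(-\infty,\omega)$. **Theorem.** Let $T\in TQ$ and let $\mu$ be a measure as above such that $\widehat T$ is $\mu$-exact. Then for every integer $k\neq 0$ the following are equivalent: 1. there is an integer $N>0$ such that $\overline T$ has a periodic orbit with vertical rotation number $k/N$; 2. $T$ has no rotational invariant circle. -/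

import Mathlib

open MeasureTheory Filter Topology

noncomputable section

/-- The cylinder `S¹ × ℝ` with `S¹ = ℝ / ℤ`; coordinates `(φ, I)`. -/
abbrev Cylinder : Type := UnitAddCircle × ℝ

/-- The torus `ℝ² / ℤ²`. -/
abbrev Torus : Type := UnitAddCircle × UnitAddCircle

/-- The covering map from the plane to the cylinder. -/
def cylProj (z : ℝ × ℝ) : Cylinder := ((z.1 : UnitAddCircle), z.2)

/-- The covering map from the plane to the torus. -/
def torusProj (z : ℝ × ℝ) : Torus := ((z.1 : UnitAddCircle), (z.2 : UnitAddCircle))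

/-- The representative in `[0, 1)` of a point of the circle. -/
def circleRep (x : UnitAddCircle) : ℝ := (AddCircle.equivIco (1 : ℝ) 0 x : ℝ)

/-- The map of the cylinder induced by a map of the plane, computed on representatives
(see `inducedCylMap_cylProj`). -/
def inducedCylMap (f : ℝ × ℝ → ℝ × ℝ) (x : Cylinder) : Cylinder :=
  cylProj (f (circleRep x.1, x.2))

/-- The map of the torus induced by a map of the plane, computed on representatives
(see `inducedTorusMap_torusProj`). -/
def inducedTorusMap (f : ℝ × ℝ → ℝ × ℝ) (x : Torus) : Torus :=
  torusProj (f (circleRep x.1, circleRep x.2))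

/-- `C¹` diffeomorphisms of the plane. -/
def IsC1Diffeo (f : ℝ × ℝ → ℝ × ℝ) : Prop :=
  ContDiff ℝ 1 f ∧
    ∃ g : ℝ × ℝ → ℝ × ℝ, ContDiff ℝ 1 g ∧ Function.LeftInverse g f ∧ Function.RightInverse g f

/-- The set `D_r¹(ℝ²)` of lifts of `C¹` twist diffeomorphisms of the cylinder.
As `cylProj` is a local diffeomorphism and `f` is a `C¹` diffeomorphism, a homeomorphism of the
cylinder that is lifted by `f` is the same thing as a `C¹` diffeomorphism lifted by `f`. -/
structure IsTwistLift (f : ℝ × ℝ → ℝ × ℝ) : Prop where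
  diffeo : IsC1Diffeo f
  snd_atTop : ∀ φ : ℝ, Tendsto (fun I : ℝ => (f (φ, I)).2) atTop atTop
  snd_atBot : ∀ φ : ℝ, Tendsto (fun I : ℝ => (f (φ, I)).2) atBot atBot
  twist : ∀ φ I : ℝ, 0 < deriv (fun J : ℝ => (f (φ, J)).1) I
  fst_atTop : ∀ φ : ℝ, Tendsto (fun I : ℝ => (f (φ, I)).1) atTop atTop
  fst_atBot : ∀ φ : ℝ, Tendsto (fun I : ℝ => (f (φ, I)).1) atBot atBot
  lift : ∃ F : Cylinder ≃ₜ Cylinder, ∀ z, F (cylProj z) = cylProj (f z)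

/-- The set `TQ`: twist lifts that induce a map of the torus homotopic to
`(φ, I) ↦ (φ + I, I)`. -/
structure IsTQ (T : ℝ × ℝ → ℝ × ℝ) : Prop extends IsTwistLift T where
  snd_add_one_left : ∀ φ I : ℝ, (T (φ + 1, I)).2 = (T (φ, I)).2
  snd_add_one_right : ∀ φ I : ℝ, (T (φ, I + 1)).2 = (T (φ, I)).2 + 1
  fst_add_one_left : ∀ φ I : ℝ, (T (φ + 1, I)).1 = (T (φ, I)).1 + 1
  fst_add_one_right : ∀ φ I : ℝ, (T (φ, I + 1)).1 = (T (φ, I)).1 + 1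

/-- `F` is `μ`-exact: `μ` is `F`-invariant and the net flux of `F` through every open set
homeomorphic to the cylinder, with compact boundary, vanishes. -/
structure IsMuExact (μ : Measure Cylinder) (F : Cylinder → Cylinder) : Prop where
  invariant : MeasurePreserving F μ μ
  flux : ∀ A : Set Cylinder, IsOpen A → Nonempty (A ≃ₜ Cylinder) → IsCompact (frontier A) →
    μ (F '' A \ A) = μ (A \ F '' A)

/-- `C` is a rotational invariant circle for `T`: a homotopically non-trivial simple closed curve
on the cylinder that is mapped onto itself by the induced map. -/
def IsRotationalInvariantCircle (T : ℝ × ℝ → ℝ × ℝ) (C : Set Cylinder) : Prop :=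
  (∃ γ : C(UnitAddCircle, Cylinder),
    Function.Injective γ ∧ ¬ γ.Nullhomotopic ∧ Set.range γ = C) ∧
  inducedCylMap T '' C = C

/-- `O` is a periodic orbit of `F`. -/
def IsPeriodicOrbit (F : Torus → Torus) (O : Set Torus) : Prop :=
  ∃ x ∈ Function.periodicPts F, O = Set.range fun n : ℕ => F^[n] x

/-- The point `z` of the plane has rotation vector `v`, with values in the extended reals. -/
def HasRotationVector (T : ℝ × ℝ → ℝ × ℝ) (z : ℝ × ℝ) (v : EReal × EReal) : Prop :=
  Tendsto (fun n : ℕ =>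
      (((((T^[n] z).1 - z.1) / n : ℝ) : EReal), ((((T^[n] z).2 - z.2) / n : ℝ) : EReal)))
    atTop (𝓝 v)

/-- The set `O` (a periodic orbit, say) of points of the torus has vertical rotation number `ω`:
all lifts of all of its points have rotation vector `(+∞, ω)` or `(-∞, ω)`. -/
def HasVerticalRotationNumber (T : ℝ × ℝ → ℝ × ℝ) (O : Set Torus) (ω : ℝ) : Prop :=
  ∀ z : ℝ × ℝ, torusProj z ∈ O →
    HasRotationVector T z (⊤, (ω : EReal)) ∨ HasRotationVector T z (⊥, (ω : EReal))

theorem coe_circleRep (x : UnitAddCircle) : ((circleRep x : ℝ) : UnitAddCircle) = x :=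
  AddCircle.coe_equivIco

theorem exists_int_add_eq {a b : ℝ} (h : (a : UnitAddCircle) = b) : ∃ m : ℤ, b = a + m := by
  have h0 : ((b - a : ℝ) : UnitAddCircle) = 0 := by
    rw [AddCircle.coe_sub, h, sub_self]
  obtain ⟨m, hm⟩ := (AddCircle.coe_eq_zero_iff (1 : ℝ)).1 h0
  refine ⟨m, ?_⟩
  simp only [zsmul_eq_mul, mul_one] at hm
  linarith

theorem map_add_int_of_map_add_one {g : ℝ → UnitAddCircle} (h : ∀ x, g (x + 1) = g x) (m : ℤ)
    (x : ℝ) : g (x + m) = g x := by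
  have hp : Function.Periodic g 1 := h
  simpa using hp.int_mul m x

/-- The map `inducedCylMap f` is the one that `f` lifts. -/
theorem inducedCylMap_cylProj {f : ℝ × ℝ → ℝ × ℝ} (hf : IsTwistLift f) (z : ℝ × ℝ) :
    inducedCylMap f (cylProj z) = cylProj (f z) := by
  obtain ⟨F, hF⟩ := hf.lift
  have h : cylProj (circleRep (cylProj z).1, (cylProj z).2) = cylProj z := by
    simp [cylProj, coe_circleRep]
  rw [inducedCylMap, ← hF, h, hF]

/-- The map `inducedTorusMap T` is the one that `T` lifts. -/
theorem inducedTorusMap_torusProj {T : ℝ × ℝ → ℝ × ℝ} (hT : IsTQ T) (z : ℝ × ℝ) :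
    inducedTorusMap T (torusProj z) = torusProj (T z) := by
  have hφ : ∀ (φ I : ℝ) (m : ℤ), torusProj (T (φ + m, I)) = torusProj (T (φ, I)) := by
    intro φ I m
    refine Prod.ext ?_ ?_
    · exact map_add_int_of_map_add_one (g := fun x => ((T (x, I)).1 : UnitAddCircle))
        (fun x => by simp [hT.fst_add_one_left]) m φ
    · exact map_add_int_of_map_add_one (g := fun x => ((T (x, I)).2 : UnitAddCircle))
        (fun x => by simp [hT.snd_add_one_left]) m φ
  have hI : ∀ (φ I : ℝ) (m : ℤ), torusProj (T (φ, I + m)) = torusProj (T (φ, I)) := by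
    intro φ I m
    refine Prod.ext ?_ ?_
    · exact map_add_int_of_map_add_one (g := fun x => ((T (φ, x)).1 : UnitAddCircle))
        (fun x => by simp [hT.fst_add_one_right]) m I
    · exact map_add_int_of_map_add_one (g := fun x => ((T (φ, x)).2 : UnitAddCircle))
        (fun x => by simp [hT.snd_add_one_right]) m I
  obtain ⟨φ, I⟩ := z
  obtain ⟨m, hm⟩ := exists_int_add_eq (coe_circleRep (φ : UnitAddCircle))
  obtain ⟨l, hl⟩ := exists_int_add_eq (coe_circleRep (I : UnitAddCircle))
  have h1 := hφ (circleRep φ) I m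
  have h2 := hI (circleRep φ) (circleRep I) l
  rw [← hm] at h1
  rw [← hl] at h2
  rw [h1, h2]
  rfl

end

/-!
An orbit segment of `T` is determined by its successive horizontal positions, and the twist makes
the momenta before and after a step monotone functions of the two neighbouring positions. Perron's
method therefore produces orbit segments with prescribed end positions between any subsolution and
any supersolution of the orbit equations.

Let `U` be the open region swept out from the lower half-plane by applying `T` and moving down, over
and over again. If `U` is bounded above, then zero flux makes `T '' U` dense in `U`, which forces
the boundary of `U` to be an invariant graph over the circle. If it is not, then some pseudo-orbit
of `T` that may jump down climbs by more than `k`; zero flux gives an orbit with the same horizontal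
displacement that does not climb, and between the two there is an orbit that climbs by exactly `k`.

Conversely, an essential closed curve separates the two ends of the cylinder, so an invariant one
bounds the vertical motion of every orbit.
-/

noncomputable section

/-! ### Periodic functions on the plane -/

theorem isOpenQuotientMap_cylProj : IsOpenQuotientMap cylProj :=
  QuotientAddGroup.isOpenQuotientMap_mk.prodMap .id

theorem isOpenQuotientMap_torusProj : IsOpenQuotientMap torusProj :=
  QuotientAddGroup.isOpenQuotientMap_mk.prodMap QuotientAddGroup.isOpenQuotientMap_mk

theorem cylProj_eq_cylProj_iff {z w : ℝ × ℝ} :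
    cylProj z = cylProj w ↔ ∃ m : ℤ, w = z + ((m : ℝ), 0) := by
  constructor
  · intro h
    obtain ⟨h₁, h₂⟩ := Prod.ext_iff.1 h
    obtain ⟨m, hm⟩ := exists_int_add_eq h₁
    exact ⟨m, Prod.ext hm (by simpa [cylProj] using h₂.symm)⟩
  · rintro ⟨m, rfl⟩
    ext <;> simp [cylProj]

theorem torusProj_eq_torusProj_iff {z w : ℝ × ℝ} :
    torusProj z = torusProj w ↔ ∃ m l : ℤ, w = z + ((m : ℝ), (l : ℝ)) := by
  constructor
  · intro h
    obtain ⟨h₁, h₂⟩ := Prod.ext_iff.1 h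
    obtain ⟨m, hm⟩ := exists_int_add_eq h₁
    obtain ⟨l, hl⟩ := exists_int_add_eq h₂
    exact ⟨m, l, Prod.ext hm hl⟩
  · rintro ⟨m, l, rfl⟩
    ext <;> simp [torusProj]

theorem uniformContinuous_torusProj : UniformContinuous torusProj :=
  (uniformContinuous_addMonoidHom_of_continuous
    (f := QuotientAddGroup.mk' (AddSubgroup.zmultiples (1 : ℝ))) continuous_quotient_mk').prodMap
  (uniformContinuous_addMonoidHom_of_continuous
    (f := QuotientAddGroup.mk' (AddSubgroup.zmultiples (1 : ℝ))) continuous_quotient_mk')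

section Periodic

variable {X : Type*} {g : ℝ × ℝ → X}

theorem map_add_int_left_of_periodic (h : Function.Periodic g (1, 0)) (z : ℝ × ℝ) (m : ℤ) :
    g (z + ((m : ℝ), 0)) = g z := by
  simpa using h.zsmul m z

theorem map_add_int_of_periodic (h₁ : Function.Periodic g (1, 0)) (h₂ : Function.Periodic g (0, 1))
    (z : ℝ × ℝ) (m l : ℤ) : g (z + ((m : ℝ), (l : ℝ))) = g z := by
  simpa using (h₁.zsmul m).add_period (h₂.zsmul l) z

theorem exists_eq_comp_torusProj [TopologicalSpace X] (h₁ : Function.Periodic g (1, 0))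
    (h₂ : Function.Periodic g (0, 1)) (hg : Continuous g) :
    ∃ f : C(Torus, X), g = f ∘ torusProj := by
  have hfactors : Function.FactorsThrough (⟨g, hg⟩ : C(ℝ × ℝ, X)) torusProj := by
    intro z w hzw
    obtain ⟨m, l, rfl⟩ := torusProj_eq_torusProj_iff.1 hzw
    exact (map_add_int_of_periodic h₁ h₂ z m l).symm
  let p : C(ℝ × ℝ, Torus) := ⟨torusProj, isOpenQuotientMap_torusProj.continuous⟩
  have hp : IsQuotientMap p := isOpenQuotientMap_torusProj.isQuotientMap
  exact ⟨hp.lift ⟨g, hg⟩ hfactors, congrArg DFunLike.coe (hp.lift_comp ⟨g, hg⟩ hfactors).symm⟩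

theorem uniformContinuous_of_periodic [UniformSpace X] (h₁ : Function.Periodic g (1, 0))
    (h₂ : Function.Periodic g (0, 1)) (hg : Continuous g) : UniformContinuous g := by
  obtain ⟨f, rfl⟩ := exists_eq_comp_torusProj h₁ h₂ hg
  exact (CompactSpace.uniformContinuous_of_continuous f.continuous).comp uniformContinuous_torusProj

theorem exists_norm_le_of_periodic [SeminormedAddCommGroup X] (h₁ : Function.Periodic g (1, 0))
    (h₂ : Function.Periodic g (0, 1)) (hg : Continuous g) : ∃ C, ∀ z, ‖g z‖ ≤ C := by
  obtain ⟨f, rfl⟩ := exists_eq_comp_torusProj h₁ h₂ hg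
  obtain ⟨C, hC⟩ := isCompact_univ.exists_bound_of_continuousOn f.continuous.continuousOn
  exact ⟨C, fun z => hC _ (Set.mem_univ _)⟩

end Periodic

/-! ### Twist homeomorphisms and momenta -/

/-- The topological counterpart of `TQ`: homeomorphisms of the plane with the equivariance of the
elements of `TQ` that move the points of every vertical line strictly to the right as the height
increases. Properness in `I` is a consequence of the equivariance. -/
structure IsTwistHomeo (T : ℝ × ℝ → ℝ × ℝ) : Prop where
  isHomeomorph : IsHomeomorph T
  map_add_left : ∀ z, T (z + (1, 0)) = T z + (1, 0)
  map_add_right : ∀ z, T (z + (0, 1)) = T z + (1, 1)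
  strictMono_fst : ∀ x, StrictMono fun I => (T (x, I)).1

theorem isHomeomorph_iterate {X : Type*} [TopologicalSpace X] {f : X → X} (hf : IsHomeomorph f)
    (n : ℕ) : IsHomeomorph f^[n] := by
  induction n with
  | zero => exact .id
  | succ n ih => exact ih.comp hf

theorem IsC1Diffeo.isHomeomorph {f : ℝ × ℝ → ℝ × ℝ} (hf : IsC1Diffeo f) : IsHomeomorph f :=
  let ⟨hc, _, hg, hl, hr⟩ := hf
  isHomeomorph_iff_exists_inverse.2 ⟨hc.continuous, _, hl, hr, hg.continuous⟩

theorem IsTQ.isTwistHomeo {T : ℝ × ℝ → ℝ × ℝ} (hT : IsTQ T) : IsTwistHomeo T where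
  isHomeomorph := hT.diffeo.isHomeomorph
  map_add_left := fun ⟨x, I⟩ => by
    ext <;> simp [hT.fst_add_one_left, hT.snd_add_one_left]
  map_add_right := fun ⟨x, I⟩ => by
    ext <;> simp [hT.fst_add_one_right, hT.snd_add_one_right]
  strictMono_fst x := strictMono_of_deriv_pos (hT.twist x)

/-- The momentum `I` for which `T (x, I)` lies over `y`. -/
def momOut (T : ℝ × ℝ → ℝ × ℝ) (x y : ℝ) : ℝ := Function.invFun (fun I => (T (x, I)).1) y

/-- The momentum at `y` of the orbit that comes from `x`. -/
def momIn (T : ℝ × ℝ → ℝ × ℝ) (x y : ℝ) : ℝ := (T (x, momOut T x y)).2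

namespace IsTwistHomeo

variable {T : ℝ × ℝ → ℝ × ℝ}

theorem continuous (h : IsTwistHomeo T) : Continuous T := h.isHomeomorph.continuous

theorem injective (h : IsTwistHomeo T) : Function.Injective T := h.isHomeomorph.injective

theorem map_add_int (h : IsTwistHomeo T) (z : ℝ × ℝ) (m l : ℤ) :
    T (z + ((m : ℝ), (l : ℝ))) = T z + ((m : ℝ) + l, (l : ℝ)) := by
  have hper := map_add_int_of_periodic (g := fun w => T w - (w.1 + w.2, w.2))
    (fun w => by ext <;> simp [h.map_add_left]; ring)
    (fun w => by ext <;> simp [h.map_add_right]; ring) z m l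
  rw [sub_eq_iff_eq_add] at hper
  rw [hper]
  ext <;> simp <;> ring

theorem iterate_add_int (h : IsTwistHomeo T) (n : ℕ) (z : ℝ × ℝ) (m l : ℤ) :
    T^[n] (z + ((m : ℝ), (l : ℝ))) = T^[n] z + ((m : ℝ) + n * l, (l : ℝ)) := by
  induction n with
  | zero => simp
  | succ n ih =>
    have hstep := h.map_add_int (T^[n] z) (m + n * l) l
    push_cast at hstep
    rw [Function.iterate_succ_apply', ih, hstep, Function.iterate_succ_apply', Nat.cast_succ]
    ring_nf

theorem iterate_add_left (h : IsTwistHomeo T) (n : ℕ) (z : ℝ × ℝ) :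
    T^[n] (z + (1, 0)) = T^[n] z + (1, 0) := by
  simpa using h.iterate_add_int n z 1 0

theorem exists_norm_iterate_sub_le (h : IsTwistHomeo T) (n : ℕ) :
    ∃ C, ∀ z, ‖T^[n] z - (z.1 + n * z.2, z.2)‖ ≤ C := by
  have hc := (isHomeomorph_iterate h.isHomeomorph n).continuous
  refine exists_norm_le_of_periodic (fun z => ?_) (fun z => ?_) (by fun_prop)
  · rw [h.iterate_add_left]
    ext <;> simp
    ring
  · have hadd := h.iterate_add_int n z 0 1
    simp only [Int.cast_zero, Int.cast_one, mul_one, zero_add] at hadd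
    rw [hadd]
    ext <;> simp
    ring

theorem exists_abs_iterate_snd_sub_le (h : IsTwistHomeo T) (n : ℕ) :
    ∃ C, ∀ z, |(T^[n] z).2 - z.2| ≤ C :=
  let ⟨C, hC⟩ := h.exists_norm_iterate_sub_le n
  ⟨C, fun z => (norm_snd_le _).trans (hC z)⟩

theorem exists_abs_iterate_fst_sub_le (h : IsTwistHomeo T) (n : ℕ) :
    ∃ C, ∀ z, |(T^[n] z).1 - (z.1 + n * z.2)| ≤ C :=
  let ⟨C, hC⟩ := h.exists_norm_iterate_sub_le n
  ⟨C, fun z => (norm_fst_le _).trans (hC z)⟩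

theorem surjective_iterate_fst (h : IsTwistHomeo T) {n : ℕ} (hn : n ≠ 0) (x : ℝ) :
    Function.Surjective fun I => (T^[n] (x, I)).1 := by
  obtain ⟨C, hC⟩ := h.exists_abs_iterate_fst_sub_le n
  have hc := (isHomeomorph_iterate h.isHomeomorph n).continuous
  have hn' : (n : ℝ) ≠ 0 := Nat.cast_ne_zero.2 hn
  refine fun y => mem_range_of_exists_le_of_exists_ge (by fun_prop)
    ⟨(y - x - C) / n, ?_⟩ ⟨(y - x + C) / n, ?_⟩
  · have hle := (abs_le.1 (hC (x, (y - x - C) / n))).2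
    rw [mul_div_cancel₀ _ hn'] at hle
    linarith
  · have hge := (abs_le.1 (hC (x, (y - x + C) / n))).1
    rw [mul_div_cancel₀ _ hn'] at hge
    linarith

theorem apply_momOut (h : IsTwistHomeo T) (x y : ℝ) : T (x, momOut T x y) = (y, momIn T x y) :=
  Prod.ext (Function.invFun_eq (h.surjective_iterate_fst one_ne_zero x y)) rfl

theorem momOut_fst (h : IsTwistHomeo T) (z : ℝ × ℝ) : momOut T z.1 (T z).1 = z.2 :=
  (h.strictMono_fst z.1).injective (congrArg Prod.fst (h.apply_momOut z.1 (T z).1) :)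

theorem momIn_fst (h : IsTwistHomeo T) (z : ℝ × ℝ) : momIn T z.1 (T z).1 = (T z).2 := by
  rw [momIn, h.momOut_fst]

theorem lt_momOut_iff (h : IsTwistHomeo T) {x y c : ℝ} : c < momOut T x y ↔ (T (x, c)).1 < y := by
  rw [← (h.strictMono_fst x).lt_iff_lt, h.apply_momOut]

theorem momOut_lt_iff (h : IsTwistHomeo T) {x y c : ℝ} : momOut T x y < c ↔ y < (T (x, c)).1 := by
  rw [← (h.strictMono_fst x).lt_iff_lt, h.apply_momOut]

theorem strictMono_momOut (h : IsTwistHomeo T) (x : ℝ) : StrictMono (momOut T x) :=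
  fun y y' hy => by
  rwa [h.lt_momOut_iff, h.apply_momOut]

theorem continuous_momOut (h : IsTwistHomeo T) : Continuous fun z : ℝ × ℝ => momOut T z.1 z.2 := by
  have hc := h.continuous
  refine continuous_iff_lower_upperSemicontinuous.2 ⟨?_, ?_⟩
  · refine lowerSemicontinuous_iff_isOpen_preimage.2 fun c => ?_
    simp only [Set.preimage, Set.mem_Ioi, h.lt_momOut_iff]
    exact isOpen_lt (by fun_prop) (by fun_prop)
  · refine upperSemicontinuous_iff_isOpen_preimage.2 fun c => ?_
    simp only [Set.preimage, Set.mem_Iio, h.momOut_lt_iff]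
    exact isOpen_lt (by fun_prop) (by fun_prop)

theorem continuous_momIn (h : IsTwistHomeo T) : Continuous fun z : ℝ × ℝ => momIn T z.1 z.2 := by
  have hOut := h.continuous_momOut
  have hc := h.continuous
  unfold momIn
  fun_prop

theorem mom_add_int (h : IsTwistHomeo T) (x y : ℝ) (m l : ℤ) :
    momOut T (x + m) (y + m + l) = momOut T x y + l ∧
      momIn T (x + m) (y + m + l) = momIn T x y + l := by
  have hshift := h.map_add_int (x, momOut T x y) m l
  rw [h.apply_momOut] at hshift
  have hOut := h.momOut_fst ((x, momOut T x y) + ((m : ℝ), (l : ℝ)))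
  have hIn := h.momIn_fst ((x, momOut T x y) + ((m : ℝ), (l : ℝ)))
  rw [hshift] at hOut hIn
  simp only [Prod.mk_add_mk, ← add_assoc] at hOut hIn
  exact ⟨hOut, hIn⟩

theorem momOut_add_int (h : IsTwistHomeo T) (x y : ℝ) (m : ℤ) :
    momOut T (x + m) (y + m) = momOut T x y := by
  simpa using (h.mom_add_int x y m 0).1

theorem momIn_add_int (h : IsTwistHomeo T) (x y : ℝ) (m : ℤ) :
    momIn T (x + m) (y + m) = momIn T x y := by
  simpa using (h.mom_add_int x y m 0).2

theorem strictAnti_momIn (h : IsTwistHomeo T) (y : ℝ) : StrictAnti fun x => momIn T x y := by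
  have hcont : Continuous fun x => momIn T x y := by
    have := h.continuous_momIn
    fun_prop
  have hinj : Function.Injective fun x => momIn T x y := fun x x' hx => by
    have himage : T (x, momOut T x y) = T (x', momOut T x' y) := by
      rw [h.apply_momOut, h.apply_momOut]
      exact Prod.ext rfl hx
    exact congrArg Prod.fst (h.injective himage)
  refine (hcont.strictMono_of_inj hinj).resolve_left fun hmono => ?_
  have hstep := (h.mom_add_int 0 y 1 (-1)).2
  simp only [Int.cast_one, Int.cast_neg, add_neg_cancel_right, zero_add] at hstep
  have hlt : momIn T 0 y < momIn T 1 y := hmono one_pos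
  linarith

theorem periodic_momIn_sub (h : IsTwistHomeo T) :
    Function.Periodic (fun z : ℝ × ℝ => momIn T z.1 z.2 - (z.2 - z.1)) (1, 0) ∧
      Function.Periodic (fun z : ℝ × ℝ => momIn T z.1 z.2 - (z.2 - z.1)) (0, 1) := by
  constructor <;> rintro ⟨x, y⟩
  · have hstep := (h.mom_add_int x y 1 (-1)).2
    simp only [Int.cast_one, Int.cast_neg, add_neg_cancel_right] at hstep
    simp only [Prod.mk_add_mk, add_zero, hstep]
    ring
  · have hstep := (h.mom_add_int x y 0 1).2
    simp only [Int.cast_one, Int.cast_zero, add_zero] at hstep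
    simp only [Prod.mk_add_mk, add_zero, hstep]
    ring

theorem uniformContinuous_momIn (h : IsTwistHomeo T) :
    UniformContinuous fun z : ℝ × ℝ => momIn T z.1 z.2 := by
  have hc := h.continuous_momIn
  simpa using (uniformContinuous_of_periodic h.periodic_momIn_sub.1 h.periodic_momIn_sub.2
    (by fun_prop)).add (uniformContinuous_snd.sub uniformContinuous_fst)

theorem exists_abs_momIn_sub_le (h : IsTwistHomeo T) :
    ∃ C, ∀ x y, |momIn T x y - (y - x)| ≤ C :=
  have hc := h.continuous_momIn
  let ⟨C, hC⟩ := exists_norm_le_of_periodic h.periodic_momIn_sub.1 h.periodic_momIn_sub.2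
    (by fun_prop)
  ⟨C, fun x y => hC (x, y)⟩

end IsTwistHomeo

/-! ### Perron's method -/

section Perron

variable {ι α β : Type*} [DecidableEq ι] [LinearOrder α] [TopologicalSpace α] [OrderTopology α]
  [LinearOrder β] [TopologicalSpace β] [OrderClosedTopology β]
  {F : ι → (ι → α) → β} {c : ι → β}

theorem le_apply_of_isLUB (hcont : ∀ i x, Continuous fun t => F i (Function.update x i t))
    (hmono : ∀ i x y, x ≤ y → x i = y i → F i x ≤ F i y) {P : Set (ι → α)} (hne : P.Nonempty)
    (hP : ∀ w ∈ P, ∀ i, c i ≤ F i w) {x : ι → α} (hx : IsLUB P x) (i : ι) : c i ≤ F i x := by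
  have hclosed : IsClosed {t | c i ≤ F i (Function.update x i t)} :=
    isClosed_le continuous_const (hcont i x)
  have hsub : Function.eval i '' P ⊆ {t | c i ≤ F i (Function.update x i t)} := by
    rintro _ ⟨w, hw, rfl⟩
    refine (hP w hw i).trans (hmono i _ _ ?_ (by simp))
    exact le_update_iff.2 ⟨le_rfl, fun j _ => hx.1 hw j⟩
  simpa using closure_minimal hsub hclosed ((isLUB_pi.1 hx i).mem_closure (hne.image _))

theorem exists_update_gt_of_lt_apply [DenselyOrdered α]
    (hcont : ∀ i x, Continuous fun t => F i (Function.update x i t))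
    (hmono : ∀ i x y, x ≤ y → x i = y i → F i x ≤ F i y) {x v : ι → α} (hxv : x ≤ v)
    (hx : ∀ i, c i ≤ F i x) {i : ι} (hv : F i v ≤ c i) (hi : c i < F i x) :
    ∃ t > x i, Function.update x i t ≤ v ∧ ∀ j, c j ≤ F j (Function.update x i t) := by
  have hlt : x i < v i :=
    (hxv i).lt_of_ne fun heq => ((hmono i x v hxv heq).trans hv).not_gt hi
  have hnear : ∀ᶠ t in 𝓝[>] x i, c i < F i (Function.update x i t) ∧ t < v i := by
    refine (Filter.Eventually.and ?_ (eventually_lt_nhds hlt)).filter_mono nhdsWithin_le_nhds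
    exact ((hcont i x).tendsto (x i)).eventually_const_lt (by simpa using hi)
  have := nhdsGT_neBot_of_exists_gt ⟨v i, hlt⟩
  obtain ⟨t, ⟨hFt, htv⟩, hxt⟩ := (hnear.and self_mem_nhdsWithin).exists
  refine ⟨t, hxt, update_le_iff.2 ⟨htv.le, fun j _ => hxv j⟩, fun j => ?_⟩
  rcases eq_or_ne j i with rfl | hj
  · exact hFt.le
  · exact (hx j).trans
      (hmono j _ _ (le_update_iff.2 ⟨le_of_lt hxt, fun _ _ => le_rfl⟩) (by simp [hj]))

end Perron

theorem exists_apply_eq_between {ι α β : Type*} [DecidableEq ι]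
    [ConditionallyCompleteLinearOrder α] [TopologicalSpace α] [OrderTopology α] [DenselyOrdered α]
    [LinearOrder β] [TopologicalSpace β] [OrderClosedTopology β] {F : ι → (ι → α) → β} {c : ι → β}
    (hcont : ∀ i x, Continuous fun t => F i (Function.update x i t))
    (hmono : ∀ i x y, x ≤ y → x i = y i → F i x ≤ F i y) {u v : ι → α} (huv : u ≤ v)
    (hu : ∀ i, c i ≤ F i u) (hv : ∀ i, F i v ≤ c i) :
    ∃ x, u ≤ x ∧ x ≤ v ∧ ∀ i, F i x = c i := by
  set P : Set (ι → α) := {w | w ≤ v ∧ ∀ i, c i ≤ F i w}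
  have huP : u ∈ P := ⟨huv, hu⟩
  have hlub : IsLUB P (sSup P) := isLUB_csSup ⟨u, huP⟩ ⟨v, fun w hw => hw.1⟩
  have hsub : ∀ i, c i ≤ F i (sSup P) :=
    le_apply_of_isLUB hcont hmono ⟨u, huP⟩ (fun w hw => hw.2) hlub
  have hle : sSup P ≤ v := hlub.2 fun w hw => hw.1
  refine ⟨sSup P, hlub.1 huP, hle, fun i => le_antisymm ?_ (hsub i)⟩
  by_contra! hlt
  obtain ⟨t, ht, htv, htsub⟩ := exists_update_gt_of_lt_apply hcont hmono hle hsub (hv i) hlt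
  exact ht.not_ge (by simpa using hlub.1 ⟨htv, htsub⟩ i)

/-! ### Orbits between sub- and supersolutions -/

/-- The positions `u 0, …, u (M + 1)` of a pseudo-orbit of `T` that may jump up: the momentum with
which it arrives at `u (j + 1)` is at most the one with which it leaves. -/
def IsSuborbit (T : ℝ × ℝ → ℝ × ℝ) (M : ℕ) (u : ℕ → ℝ) : Prop :=
  ∀ j < M, momIn T (u j) (u (j + 1)) ≤ momOut T (u (j + 1)) (u (j + 2))

/-- The positions `v 0, …, v (M + 1)` of a pseudo-orbit of `T` that may jump down: the momentum with
which it arrives at `v (j + 1)` is at least the one with which it leaves. -/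
def IsSuperorbit (T : ℝ × ℝ → ℝ × ℝ) (M : ℕ) (v : ℕ → ℝ) : Prop :=
  ∀ j < M, momOut T (v (j + 1)) (v (j + 2)) ≤ momIn T (v j) (v (j + 1))

/-- The system that Perron's method is applied to: the `i`-th entry is nondecreasing in all
coordinates of `x` but the `i`-th. Its entries at `1, …, M` vanish when `x 0, …, x (M + 1)` are the
positions of an orbit, and `f` and `c` are boundary conditions at `0` and `M + 1`. -/
def orbitDefect (T : ℝ × ℝ → ℝ × ℝ) (M : ℕ) (f : ℝ → ℝ → ℝ → ℝ) (c : ℝ → ℝ) :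
    ℕ → (ℕ → ℝ) → ℝ
  | 0, x => f (x 0) (x 1) (x M)
  | j + 1, x =>
    if j < M then momOut T (x (j + 1)) (x (j + 2)) - momIn T (x j) (x (j + 1))
    else if j = M then c (x 0) - x (M + 1) else 0

section OrbitDefect

variable {T : ℝ × ℝ → ℝ × ℝ} {M : ℕ} {f : ℝ → ℝ → ℝ → ℝ} {c : ℝ → ℝ} {x : ℕ → ℝ}

theorem orbitDefect_nonneg_iff :
    (∀ i, 0 ≤ orbitDefect T M f c i x) ↔
      0 ≤ f (x 0) (x 1) (x M) ∧ IsSuborbit T M x ∧ x (M + 1) ≤ c (x 0) := by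
  refine ⟨fun h => ⟨h 0, fun j hj => ?_, ?_⟩, fun ⟨h₀, hx, hc⟩ i => ?_⟩
  · simpa [orbitDefect, hj] using h (j + 1)
  · simpa [orbitDefect] using h (M + 1)
  · cases i with
    | zero => exact h₀
    | succ j =>
      simp only [orbitDefect]
      split_ifs with hj
      exacts [sub_nonneg.2 (hx j hj), sub_nonneg.2 hc, le_rfl]

theorem orbitDefect_nonpos_iff :
    (∀ i, orbitDefect T M f c i x ≤ 0) ↔
      f (x 0) (x 1) (x M) ≤ 0 ∧ IsSuperorbit T M x ∧ c (x 0) ≤ x (M + 1) := by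
  refine ⟨fun h => ⟨h 0, fun j hj => ?_, ?_⟩, fun ⟨h₀, hx, hc⟩ i => ?_⟩
  · simpa [orbitDefect, hj] using h (j + 1)
  · simpa [orbitDefect] using h (M + 1)
  · cases i with
    | zero => exact h₀
    | succ j =>
      simp only [orbitDefect]
      split_ifs with hj
      exacts [sub_nonpos.2 (hx j hj), sub_nonpos.2 hc, le_rfl]

theorem continuous_orbitDefect_update (h : IsTwistHomeo T)
    (hf : Continuous fun p : ℝ × ℝ × ℝ => f p.1 p.2.1 p.2.2) (i : ℕ) :
    Continuous fun t => orbitDefect T M f c i (Function.update x i t) := by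
  have hupd (j : ℕ) : Continuous fun t => Function.update x i t j :=
    (continuous_apply (A := fun _ => ℝ) j).comp (continuous_const.update i continuous_id)
  have hOut := h.continuous_momOut
  have hIn := h.continuous_momIn
  cases i with
  | zero => exact hf.comp ((hupd 0).prodMk ((hupd 1).prodMk (hupd M)))
  | succ j =>
    simp only [orbitDefect, Function.update_of_ne (Nat.succ_ne_zero j).symm]
    split_ifs
    · exact (hOut.comp ((hupd _).prodMk (hupd _))).sub (hIn.comp ((hupd _).prodMk (hupd _)))
    · exact continuous_const.sub (hupd _)
    · exact continuous_const

theorem orbitDefect_mono (h : IsTwistHomeo T) (hf : ∀ p, Monotone fun q : ℝ × ℝ => f p q.1 q.2)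
    (hc : Monotone c) (i : ℕ) {y : ℕ → ℝ} (hxy : x ≤ y) (hi : x i = y i) :
    orbitDefect T M f c i x ≤ orbitDefect T M f c i y := by
  cases i with
  | zero =>
    simp only [orbitDefect, hi]
    exact hf _ (Prod.mk_le_mk.2 ⟨hxy 1, hxy M⟩)
  | succ j =>
    simp only [orbitDefect]
    split_ifs with hj hjM
    · rw [hi]
      exact sub_le_sub ((h.strictMono_momOut _).monotone (hxy _))
        ((h.strictAnti_momIn _).antitone (hxy _))
    · subst hjM
      rw [hi]
      exact sub_le_sub_right (hc (hxy 0)) _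
    · exact le_rfl

end OrbitDefect

theorem exists_int_forall_le_add (u v : ℕ → ℝ) (n : ℕ) : ∃ m : ℤ, ∀ i ≤ n, u i ≤ v i + m := by
  obtain ⟨m, hm⟩ := exists_int_ge ((Finset.range (n + 1)).sup' ⟨0, by simp⟩ (u - v))
  refine ⟨m, fun i hi => ?_⟩
  have hle := (Finset.le_sup' (u - v) (Finset.mem_range_succ_iff.2 hi)).trans hm
  simpa [sub_le_iff_le_add, add_comm] using hle

namespace IsTwistHomeo

variable {T : ℝ × ℝ → ℝ × ℝ} {M : ℕ}

theorem momOut_iterate (h : IsTwistHomeo T) (z : ℝ × ℝ) (i : ℕ) :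
    momOut T (T^[i] z).1 (T^[i + 1] z).1 = (T^[i] z).2 := by
  rw [Function.iterate_succ_apply', h.momOut_fst]

theorem momIn_iterate (h : IsTwistHomeo T) (z : ℝ × ℝ) (i : ℕ) :
    momIn T (T^[i] z).1 (T^[i + 1] z).1 = (T^[i + 1] z).2 := by
  rw [Function.iterate_succ_apply', h.momIn_fst]

theorem isSuborbit_iterate (h : IsTwistHomeo T) (M : ℕ) (z : ℝ × ℝ) :
    IsSuborbit T M fun i => (T^[i] z).1 := fun j _ => by
  rw [h.momIn_iterate, h.momOut_iterate]

theorem isSuperorbit_iterate (h : IsTwistHomeo T) (M : ℕ) (z : ℝ × ℝ) :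
    IsSuperorbit T M fun i => (T^[i] z).1 := fun j _ => by
  rw [h.momIn_iterate, h.momOut_iterate]

theorem isSuperorbit_add_int (h : IsTwistHomeo T) {v : ℕ → ℝ} (hv : IsSuperorbit T M v) (m : ℤ) :
    IsSuperorbit T M fun i => v i + m := fun j hj => by
  simpa only [h.momOut_add_int, h.momIn_add_int] using hv j hj

theorem isSuborbit_sup (h : IsTwistHomeo T) {u v : ℕ → ℝ} (hu : IsSuborbit T M u)
    (hv : IsSuborbit T M v) : IsSuborbit T M (u ⊔ v) := fun j hj => by
  rcases le_total (u (j + 1)) (v (j + 1)) with hle | hle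
  · calc momIn T ((u ⊔ v) j) ((u ⊔ v) (j + 1))
        ≤ momIn T (v j) (v (j + 1)) := by
          simpa only [Pi.sup_apply, sup_eq_right.2 hle] using
            (h.strictAnti_momIn _).antitone le_sup_right
      _ ≤ momOut T (v (j + 1)) (v (j + 2)) := hv j hj
      _ ≤ momOut T ((u ⊔ v) (j + 1)) ((u ⊔ v) (j + 2)) := by
          simpa only [Pi.sup_apply, sup_eq_right.2 hle] using
            (h.strictMono_momOut _).monotone le_sup_right
  · calc momIn T ((u ⊔ v) j) ((u ⊔ v) (j + 1))
        ≤ momIn T (u j) (u (j + 1)) := by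
          simpa only [Pi.sup_apply, sup_eq_left.2 hle] using
            (h.strictAnti_momIn _).antitone le_sup_left
      _ ≤ momOut T (u (j + 1)) (u (j + 2)) := hu j hj
      _ ≤ momOut T ((u ⊔ v) (j + 1)) ((u ⊔ v) (j + 2)) := by
          simpa only [Pi.sup_apply, sup_eq_left.2 hle] using
            (h.strictMono_momOut _).monotone le_sup_left

theorem exists_iterate_fst_eq (h : IsTwistHomeo T) {x : ℕ → ℝ} (hsub : IsSuborbit T M x)
    (hsup : IsSuperorbit T M x) : ∃ z, ∀ i ≤ M + 1, (T^[i] z).1 = x i := by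
  have horbit : ∀ i ≤ M, T^[i] (x 0, momOut T (x 0) (x 1)) = (x i, momOut T (x i) (x (i + 1))) := by
    intro i
    induction i with
    | zero => simp
    | succ i ih =>
      intro hi
      rw [Function.iterate_succ_apply', ih (by lia), h.apply_momOut,
        (hsup i hi).antisymm (hsub i hi)]
  refine ⟨(x 0, momOut T (x 0) (x 1)), fun i hi => ?_⟩
  rcases hi.lt_or_eq with hlt | rfl
  · rw [horbit i (Nat.lt_succ_iff.1 hlt)]
  · rw [Function.iterate_succ_apply', horbit M le_rfl, h.apply_momOut]

theorem exists_orbit_between (h : IsTwistHomeo T) {f : ℝ → ℝ → ℝ → ℝ} {c : ℝ → ℝ}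
    (hf : Continuous fun p : ℝ × ℝ × ℝ => f p.1 p.2.1 p.2.2)
    (hfm : ∀ p, Monotone fun q : ℝ × ℝ => f p q.1 q.2) (hc : Monotone c)
    {u v : ℕ → ℝ} (hu : IsSuborbit T M u) (hv : IsSuperorbit T M v)
    (huv : ∀ i ≤ M + 1, u i ≤ v i)
    (hu₀ : 0 ≤ f (u 0) (u 1) (u M)) (hv₀ : f (v 0) (v 1) (v M) ≤ 0)
    (huc : u (M + 1) ≤ c (u 0)) (hvc : c (v 0) ≤ v (M + 1)) :
    ∃ z : ℝ × ℝ, (∀ i ≤ M + 1, u i ≤ (T^[i] z).1) ∧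
      f z.1 (T z).1 (T^[M] z).1 = 0 ∧ (T^[M + 1] z).1 = c z.1 := by
  have hsup (i) (hi : i ≤ M + 1) : (u ⊔ v) i = v i := sup_eq_right.2 (huv i hi)
  obtain ⟨x, hux, -, hx⟩ := exists_apply_eq_between (F := orbitDefect T M f c) (c := 0)
    (fun i x => continuous_orbitDefect_update h hf i)
    (fun i x y hxy hi => orbitDefect_mono h hfm hc i hxy hi) (le_sup_left : u ≤ u ⊔ v)
    (orbitDefect_nonneg_iff.2 ⟨hu₀, hu, huc⟩) <| orbitDefect_nonpos_iff.2 <| by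
      rw [hsup 0 (by lia), hsup 1 (by lia), hsup M (by lia), hsup (M + 1) le_rfl]
      refine ⟨hv₀, fun j hj => ?_, hvc⟩
      rw [hsup j (by lia), hsup (j + 1) (by lia), hsup (j + 2) (by lia)]
      exact hv j hj
  obtain ⟨hf₁, hsub, hc₁⟩ := orbitDefect_nonneg_iff.1 fun i => (hx i).ge
  obtain ⟨hf₂, hsuper, hc₂⟩ := orbitDefect_nonpos_iff.1 fun i => (hx i).le
  obtain ⟨z, hz⟩ := h.exists_iterate_fst_eq hsub hsuper
  have hz₀ : z.1 = x 0 := hz 0 (by lia)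
  have hz₁ : (T z).1 = x 1 := hz 1 (by lia)
  refine ⟨z, fun i hi => (hux i).trans_eq (hz i hi).symm, ?_, ?_⟩
  · rw [hz₀, hz₁, hz M (by lia)]
    exact hf₂.antisymm hf₁
  · rw [hz₀, hz (M + 1) le_rfl]
    exact hc₁.antisymm hc₂

theorem exists_iterate_eq_add (h : IsTwistHomeo T) {s k : ℤ} (hk : 0 ≤ k) {w : ℝ × ℝ}
    (hw₁ : (T^[M + 1] w).1 = w.1 + s) (hw₂ : (T^[M + 1] w).2 ≤ w.2) {v : ℕ → ℝ}
    (hv : IsSuperorbit T M v) (hvs : v (M + 1) = v 0 + s)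
    (hvk : momOut T (v 0) (v 1) + k ≤ momIn T (v M) (v (M + 1))) :
    ∃ z : ℝ × ℝ, T^[M + 1] z = z + ((s : ℝ), (k : ℝ)) := by
  obtain ⟨m, hm⟩ := exists_int_forall_le_add (fun i => (T^[i] w).1) v (M + 1)
  have hOut := h.continuous_momOut
  have hIn := h.continuous_momIn
  have hk' : (0 : ℝ) ≤ k := Int.cast_nonneg hk
  let f (p q r : ℝ) : ℝ := momOut T p q - momIn T r (p + s) + k
  have hf : Continuous fun p : ℝ × ℝ × ℝ => f p.1 p.2.1 p.2.2 := by
    unfold f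
    fun_prop
  have hfm (p : ℝ) : Monotone fun q : ℝ × ℝ => f p q.1 q.2 := by
    rintro ⟨q, r⟩ ⟨q', r'⟩ ⟨hq, hr⟩
    exact add_le_add_left (sub_le_sub ((h.strictMono_momOut p).monotone hq)
      ((h.strictAnti_momIn (p + s)).antitone hr)) _
  have hf_orbit {z : ℝ × ℝ} (hz : (T^[M + 1] z).1 = z.1 + s) :
      f z.1 (T z).1 (T^[M] z).1 = z.2 - (T^[M + 1] z).2 + k := by
    have harrive := h.momIn_iterate z M
    rw [hz] at harrive
    simp only [f, h.momOut_fst, harrive]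
  have hf_super : f (v 0 + m) (v 1 + m) (v M + m) ≤ 0 := by
    simp only [f, add_right_comm (v 0), ← hvs, h.momOut_add_int, h.momIn_add_int]
    linarith
  obtain ⟨z, -, hz₂, hz₁⟩ := h.exists_orbit_between hf hfm (fun p q hpq => add_le_add_left hpq s)
    (h.isSuborbit_iterate M w) (h.isSuperorbit_add_int hv m) hm
    ((by linarith : 0 ≤ w.2 - (T^[M + 1] w).2 + k).trans_eq (hf_orbit hw₁).symm) hf_super hw₁.le
    (by simp only [hvs, add_right_comm, le_refl])
  rw [hf_orbit hz₁] at hz₂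
  refine ⟨z, Prod.ext hz₁ ?_⟩
  simp only [Prod.snd_add]
  linarith

end IsTwistHomeo

/-! ### Orbits that do not climb -/

/-- No periodic region that contains everything low enough and nothing high enough is moved into
itself or onto a larger region by an iterate of `T`, up to sets without interior. -/
def IsDriftFree (T : ℝ × ℝ → ℝ × ℝ) : Prop :=
  ∀ (n : ℕ) (V : Set (ℝ × ℝ)) (B : ℝ), MeasurableSet V → Function.Periodic (· ∈ V) (1, 0) →
    (∀ z : ℝ × ℝ, z.2 < -B → z ∈ V) → (∀ z ∈ V, z.2 < B) →
    (T^[n] '' V ⊆ V ∨ V ⊆ T^[n] '' V) → interior (symmDiff (T^[n] '' V) V) = ∅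

/-- The points that `T^[n]` moves to the right by exactly `s`. -/
def returnSet (T : ℝ × ℝ → ℝ × ℝ) (n : ℕ) (s : ℤ) : Set (ℝ × ℝ) :=
  {z | (T^[n] z).1 = z.1 + s}

/-- The height of the highest point of `returnSet T n s` over `x`; see
`IsTwistHomeo.isGreatest_topReturn`. -/
def topReturn (T : ℝ × ℝ → ℝ × ℝ) (n : ℕ) (s : ℤ) (x : ℝ) : ℝ :=
  sSup {I | (x, I) ∈ returnSet T n s}

theorem isClosed_hypograph_of_isClosed {K : Set (ℝ × ℝ)} (hK : IsClosed K) {C : ℝ}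
    (hC : ∀ z ∈ K, |z.2| ≤ C) : IsClosed {z : ℝ × ℝ | ∃ J, z.2 ≤ J ∧ (z.1, J) ∈ K} := by
  have hclosed : IsClosed {p : (ℝ × ℝ) × Set.Icc (-C) C | p.1.2 ≤ p.2 ∧ (p.1.1, (p.2 : ℝ)) ∈ K} :=
    isClosed_le (f := fun p : (ℝ × ℝ) × Set.Icc (-C) C => p.1.2) (by fun_prop) (by fun_prop)
      |>.inter (hK.preimage (f := fun p : (ℝ × ℝ) × Set.Icc (-C) C => (p.1.1, (p.2 : ℝ)))
        (by fun_prop))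
  convert isClosedMap_fst_of_compactSpace _ hclosed using 1
  ext z
  constructor
  · rintro ⟨J, hzJ, hJ⟩
    exact ⟨(z, ⟨J, abs_le.1 (hC _ hJ)⟩), ⟨hzJ, hJ⟩, rfl⟩
  · rintro ⟨⟨z, J⟩, hJ, rfl⟩
    exact ⟨J, hJ⟩

theorem nonempty_interior_diff_hypograph {u : ℝ → ℝ} (hu : IsClosed {z : ℝ × ℝ | z.2 ≤ u z.1})
    (hbdd : BddBelow (Set.range u)) {ε : ℝ} (hε : 0 < ε) {V : Set (ℝ × ℝ)}
    (hV : ∀ z : ℝ × ℝ, z.2 < u z.1 + ε → z ∈ V) :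
    (interior (V \ {z | z.2 ≤ u z.1})).Nonempty := by
  obtain ⟨x₀, hx₀⟩ := exists_lt_of_ciInf_lt (show ⨅ x, u x < (⨅ x, u x) + ε / 2 by linarith)
  let W : Set (ℝ × ℝ) := {z | (z.1, (⨅ x, u x) + ε / 2) ∈ {z : ℝ × ℝ | z.2 ≤ u z.1}ᶜ} ∩
    Prod.snd ⁻¹' Set.Ioo ((⨅ x, u x) + ε / 2) ((⨅ x, u x) + ε)
  have hW_open : IsOpen W :=
    (hu.isOpen_compl.preimage (f := fun z : ℝ × ℝ => (z.1, (⨅ x, u x) + ε / 2))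
      (by fun_prop)).inter (isOpen_Ioo.preimage continuous_snd)
  have hW : W ⊆ V \ {z | z.2 ≤ u z.1} := by
    rintro z ⟨hz₁, hz₂, hz₃⟩
    have hlt : u z.1 < (⨅ x, u x) + ε / 2 := not_le.1 hz₁
    refine ⟨hV z (hz₃.trans_le ?_), (hlt.trans hz₂).not_ge⟩
    gcongr
    exact ciInf_le hbdd z.1
  refine ⟨(x₀, (⨅ x, u x) + 3 * ε / 4), interior_maximal hW hW_open ⟨not_le.2 hx₀, ?_, ?_⟩⟩ <;>
    dsimp only <;> linarith

namespace IsTwistHomeo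

variable {T : ℝ × ℝ → ℝ × ℝ} {n M : ℕ} {s : ℤ}

theorem isClosed_returnSet (h : IsTwistHomeo T) (n : ℕ) (s : ℤ) : IsClosed (returnSet T n s) :=
  have hc := (isHomeomorph_iterate h.isHomeomorph n).continuous
  isClosed_eq (by fun_prop) (by fun_prop)

theorem iterate_add_int_left (h : IsTwistHomeo T) (n : ℕ) (x I : ℝ) (m : ℤ) :
    T^[n] (x + m, I) = T^[n] (x, I) + ((m : ℝ), 0) := by
  simpa using h.iterate_add_int n (x, I) m 0

theorem add_int_mem_returnSet_iff (h : IsTwistHomeo T) {x I : ℝ} (m : ℤ) :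
    (x + m, I) ∈ returnSet T n s ↔ (x, I) ∈ returnSet T n s := by
  simp [returnSet, h.iterate_add_int_left, add_right_comm x]

theorem exists_forall_mem_returnSet_abs_snd_le (h : IsTwistHomeo T) (hn : n ≠ 0) (s : ℤ) :
    ∃ C, ∀ z ∈ returnSet T n s, |z.2| ≤ C := by
  obtain ⟨C, hC⟩ := h.exists_abs_iterate_fst_sub_le n
  refine ⟨C + |(s : ℝ)|, fun z hz => ?_⟩
  have hdisp : |s - n * z.2| ≤ C := by
    have hzC := hC z
    rwa [show (T^[n] z).1 = z.1 + s from hz, add_sub_add_left_eq_sub] at hzC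
  calc |z.2| ≤ n * |z.2| :=
        le_mul_of_one_le_left (abs_nonneg _) (Nat.one_le_cast.2 (Nat.one_le_iff_ne_zero.2 hn))
    _ = |s - (s - n * z.2)| := by rw [sub_sub_cancel, abs_mul, Nat.abs_cast]
    _ ≤ |(s : ℝ)| + |s - n * z.2| := abs_sub _ _
    _ ≤ C + |(s : ℝ)| := by linarith

theorem isGreatest_topReturn (h : IsTwistHomeo T) (hn : n ≠ 0) (s : ℤ) (x : ℝ) :
    IsGreatest {I | (x, I) ∈ returnSet T n s} (topReturn T n s x) := by
  obtain ⟨C, hC⟩ := h.exists_forall_mem_returnSet_abs_snd_le hn s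
  have hclosed : IsClosed {I | (x, I) ∈ returnSet T n s} :=
    (h.isClosed_returnSet n s).preimage (by fun_prop)
  have hbdd : BddAbove {I | (x, I) ∈ returnSet T n s} := ⟨C, fun I hI => (abs_le.1 (hC _ hI)).2⟩
  exact ⟨hclosed.csSup_mem (h.surjective_iterate_fst hn x (x + s)) hbdd,
    fun I hI => le_csSup hbdd hI⟩

theorem topReturn_add_int (h : IsTwistHomeo T) (x : ℝ) (m : ℤ) :
    topReturn T n s (x + m) = topReturn T n s x := by
  simp only [topReturn, h.add_int_mem_returnSet_iff]

theorem isClosed_le_topReturn (h : IsTwistHomeo T) (hn : n ≠ 0) (s : ℤ) :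
    IsClosed {z : ℝ × ℝ | z.2 ≤ topReturn T n s z.1} := by
  obtain ⟨C, hC⟩ := h.exists_forall_mem_returnSet_abs_snd_le hn s
  convert isClosed_hypograph_of_isClosed (h.isClosed_returnSet n s) hC using 3 with z
  have htop := h.isGreatest_topReturn hn s z.1
  exact ⟨fun hz => ⟨_, hz, htop.1⟩, fun ⟨J, hzJ, hJ⟩ => hzJ.trans (htop.2 hJ)⟩

theorem iterate_fst_le_of_isGreatest (h : IsTwistHomeo T) {p t : ℝ}
    (ht : IsGreatest {I | (p, I) ∈ returnSet T (M + 1) s} t) {z : ℝ × ℝ} (hz₀ : z.1 ≤ p)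
    (hz₁ : (T^[M + 1] z).1 ≤ p + s) {i : ℕ} (hi : i ≤ M + 1) :
    (T^[i] z).1 ≤ (T^[i] (p, t)).1 := by
  have hK : (T^[M + 1] (p, t)).1 = p + s := ht.1
  let u : ℕ → ℝ := (fun i => (T^[i] z).1) ⊔ fun i => (T^[i] (p, t)).1
  obtain ⟨m, hm⟩ := exists_int_forall_le_add u (fun i => (T^[i] (p, t)).1) (M + 1)
  have hm₀ : (0 : ℝ) ≤ m := by simpa using le_sup_right.trans (hm 0 (by lia))
  obtain ⟨⟨q, J⟩, huy, hy₀, hy₁⟩ := h.exists_orbit_between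
    (f := fun q _ _ => p - q) (c := fun _ => p + s) (by fun_prop) (fun _ => monotone_const)
    monotone_const
    (h.isSuborbit_sup (h.isSuborbit_iterate M z) (h.isSuborbit_iterate M (p, t)))
    (h.isSuperorbit_add_int (h.isSuperorbit_iterate M (p, t)) m) hm (by simpa using hz₀)
    (by simpa using hm₀) (max_le hz₁ hK.le) (by linarith)
  obtain rfl : p = q := sub_eq_zero.1 hy₀
  have htJ : t ≤ J := (h.strictMono_fst p).le_iff_le.1 (le_sup_right.trans (huy 1 (by lia)))
  obtain rfl : J = t := (ht.2 hy₁).antisymm htJ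
  exact le_sup_left.trans (huy i hi)

theorem mem_image_of_snd_lt (h : IsTwistHomeo T) {w : ℝ × ℝ}
    (hw : w.2 < (T^[M + 1] (w.1, topReturn T (M + 1) s w.1)).2) :
    w ∈ T^[M + 1] '' {z | z.2 ≤ topReturn T (M + 1) s z.1} := by
  obtain ⟨z, rfl⟩ := (isHomeomorph_iterate h.isHomeomorph (M + 1)).surjective w
  refine ⟨z, show z.2 ≤ topReturn T (M + 1) s z.1 from not_lt.1 fun hz => ?_, rfl⟩
  have htop := h.isGreatest_topReturn M.succ_ne_zero s
  rcases le_total (T^[M + 1] z).1 (z.1 + s) with hle | hle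
  · have hfst := h.iterate_fst_le_of_isGreatest (htop z.1) le_rfl hle (i := 1) (by lia)
    exact hz.not_ge ((h.strictMono_fst z.1).le_iff_le.1 hfst)
  · obtain ⟨p, hp⟩ : ∃ p, (T^[M + 1] z).1 = p + s := ⟨_, (sub_add_cancel _ _).symm⟩
    have hend : (T^[M + 1] (p, topReturn T (M + 1) s p)).1 = p + s := (htop p).1
    have hfst := h.iterate_fst_le_of_isGreatest (htop p) (by linarith) hp.le (i := M) (by lia)
    have hsnd := (h.strictAnti_momIn (p + s)).antitone hfst
    have harrive₁ := h.momIn_iterate (p, topReturn T (M + 1) s p) M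
    have harrive₂ := h.momIn_iterate z M
    rw [hend] at harrive₁
    rw [hp] at harrive₂
    rw [harrive₁, harrive₂] at hsnd
    rw [hp, h.topReturn_add_int, h.iterate_add_int_left, Prod.snd_add, add_zero] at hw
    exact hw.not_ge hsnd

theorem exists_pos_add_le_iterate_snd (h : IsTwistHomeo T) (hn : n ≠ 0)
    (hclimb : ∀ z ∈ returnSet T n s, z.2 < (T^[n] z).2) :
    ∃ ε > 0, ∀ z ∈ returnSet T n s, z.2 + ε ≤ (T^[n] z).2 := by
  obtain ⟨C, hC⟩ := h.exists_forall_mem_returnSet_abs_snd_le hn s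
  have hc := (isHomeomorph_iterate h.isHomeomorph n).continuous
  have hcompact : IsCompact (returnSet T n s ∩ Set.Icc (0 : ℝ) 1 ×ˢ Set.Icc (-C) C) :=
    (isCompact_Icc.prod isCompact_Icc).inter_left (h.isClosed_returnSet n s)
  obtain ⟨I, hI⟩ := h.surjective_iterate_fst hn 0 (0 + s)
  obtain ⟨q, hq, hmin⟩ := hcompact.exists_isMinOn (f := fun z => (T^[n] z).2 - z.2)
    ⟨(0, I), hI, ⟨le_rfl, zero_le_one⟩, abs_le.1 (hC (0, I) hI)⟩ (by fun_prop)
  refine ⟨(T^[n] q).2 - q.2, sub_pos.2 (hclimb q hq.1), fun ⟨x, I⟩ hz => ?_⟩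
  obtain ⟨m, hm, -⟩ := existsUnique_add_zsmul_mem_Ico one_pos x 0
  rw [zero_add, zsmul_one] at hm
  have hle := hmin (a := (x + m, I))
    ⟨(h.add_int_mem_returnSet_iff m).2 hz, Set.Ico_subset_Icc_self hm, abs_le.1 (hC (x, I) hz)⟩
  simp only [Set.mem_ofPred_eq, h.iterate_add_int_left, Prod.snd_add, add_zero] at hle
  exact le_sub_iff_add_le'.1 hle

theorem exists_iterate_snd_le (h : IsTwistHomeo T) (hd : IsDriftFree T) (M : ℕ) (s : ℤ) :
    ∃ w : ℝ × ℝ, (T^[M + 1] w).1 = w.1 + s ∧ (T^[M + 1] w).2 ≤ w.2 := by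
  by_contra! hclimb
  let top := topReturn T (M + 1) s
  let V : Set (ℝ × ℝ) := {z | z.2 ≤ top z.1}
  have htop := h.isGreatest_topReturn M.succ_ne_zero s
  obtain ⟨ε, hε, hgap⟩ := h.exists_pos_add_le_iterate_snd M.succ_ne_zero hclimb
  obtain ⟨C, hC⟩ := h.exists_forall_mem_returnSet_abs_snd_le M.succ_ne_zero s
  have hV_closed : IsClosed V := h.isClosed_le_topReturn M.succ_ne_zero s
  have hVC (x : ℝ) : |top x| ≤ C := hC _ (htop x).1
  have hV : V ⊆ T^[M + 1] '' V := fun z hz =>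
    h.mem_image_of_snd_lt (lt_of_le_of_lt hz (hclimb _ (htop z.1).1))
  have hinterior := hd (M + 1) V (C + 1) hV_closed.measurableSet
    (fun z => by simpa [V] using congrArg (z.2 ≤ ·) (h.topReturn_add_int z.1 1))
    (fun z hz => le_trans (by linarith) (abs_le.1 (hVC z.1)).1)
    (fun z hz => hz.trans_lt (by linarith [(abs_le.1 (hVC z.1)).2])) (.inr hV)
  have hbdd : BddBelow (Set.range top) := ⟨-C, by rintro _ ⟨x, rfl⟩; exact (abs_le.1 (hVC x)).1⟩
  have hnonempty := nonempty_interior_diff_hypograph hV_closed hbdd hε fun z hz =>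
    h.mem_image_of_snd_lt (hz.trans_le (hgap _ (htop z.1).1))
  exact (hnonempty.mono (interior_mono fun z hz => .inl hz)).ne_empty hinterior

end IsTwistHomeo

/-! ### Points reached by pseudo-orbits that jump down -/

/-- The points that can be reached from the lower half-plane by steps that apply `T` and then move
down. -/
inductive IsDescentReachable (T : ℝ × ℝ → ℝ × ℝ) : ℝ × ℝ → Prop
  | of_snd_neg {z : ℝ × ℝ} (hz : z.2 < 0) : IsDescentReachable T z
  | step {w z : ℝ × ℝ} (hw : IsDescentReachable T w) (hfst : z.1 = (T w).1)
    (hsnd : z.2 ≤ (T w).2) : IsDescentReachable T z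

namespace IsDescentReachable

variable {T : ℝ × ℝ → ℝ × ℝ} {z : ℝ × ℝ}

theorem of_le (hz : IsDescentReachable T z) {I : ℝ} (hI : I ≤ z.2) :
    IsDescentReachable T (z.1, I) := by
  cases hz with
  | of_snd_neg hz => exact .of_snd_neg (hI.trans_lt hz)
  | step hw hfst hsnd => exact .step hw hfst (hI.trans hsnd)

theorem add_int_left (h : IsTwistHomeo T) (hz : IsDescentReachable T z) (m : ℤ) :
    IsDescentReachable T (z + ((m : ℝ), 0)) := by
  induction hz with
  | of_snd_neg hz => exact .of_snd_neg (by simpa using hz)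
  | @step w z _ hfst hsnd ih =>
    have hT : T (w + ((m : ℝ), 0)) = T w + ((m : ℝ), 0) := by simpa using h.map_add_int w m 0
    exact .step ih (by simp [hT, hfst]) (by simpa [hT] using hsnd)

theorem exists_isSuperorbit (h : IsTwistHomeo T) (hz : IsDescentReachable T z) (hz₀ : 0 ≤ z.2) :
    ∃ M v, v (M + 1) = z.1 ∧ IsSuperorbit T M v ∧ momOut T (v 0) (v 1) < 0 ∧
      z.2 ≤ momIn T (v M) (v (M + 1)) := by
  induction hz with
  | of_snd_neg hz => exact absurd hz₀ (not_le.2 hz)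
  | @step w z _ hfst hsnd ih =>
    have hOut : momOut T w.1 z.1 = w.2 := by rw [hfst, h.momOut_fst]
    have hIn : momIn T w.1 z.1 = (T w).2 := by rw [hfst, h.momIn_fst]
    rcases lt_or_ge w.2 0 with hw₀ | hw₀
    · exact ⟨0, fun i => if i = 0 then w.1 else z.1, by simp, fun j hj => absurd hj j.not_lt_zero,
        by simpa [hOut] using hw₀, by simpa [hIn] using hsnd⟩
    · obtain ⟨M, v, hend, hv, hstart, harrive⟩ := ih hw₀
      have hinit {i : ℕ} (hi : i ≤ M + 1) : Function.update v (M + 2) z.1 i = v i :=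
        Function.update_of_ne (by lia) _ _
      have hlast : Function.update v (M + 2) z.1 (M + 2) = z.1 := Function.update_self ..
      refine ⟨M + 1, Function.update v (M + 2) z.1, hlast, fun j hj => ?_, ?_, ?_⟩
      · rcases (Nat.lt_succ_iff.1 hj).lt_or_eq with hjM | rfl
        · rw [hinit (by lia), hinit (by lia), hinit (by lia)]
          exact hv j hjM
        · rwa [hlast, hinit le_rfl, hinit (by lia), hend, hOut, ← hend]
      · rwa [hinit (by lia), hinit (by lia)]
      · rwa [hlast, hinit le_rfl, hend, hIn]

end IsDescentReachable

namespace IsTwistHomeo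

variable {T : ℝ × ℝ → ℝ × ℝ}

theorem isOpen_isDescentReachable (h : IsTwistHomeo T) : IsOpen {z | IsDescentReachable T z} := by
  refine isOpen_iff_mem_nhds.2 fun z hz => ?_
  induction hz with
  | of_snd_neg hz =>
    filter_upwards [(isOpen_Iio.preimage continuous_snd).mem_nhds (Set.mem_Iio.2 hz)] with w hw
    exact .of_snd_neg hw
  | @step w z _ hfst hsnd ih =>
    have hmap : IsOpenMap fun w' => T w' + (z - T w) :=
      (isOpenMap_add_right _).comp h.isHomeomorph.isOpenMap
    have hnhds := hmap.image_mem_nhds ih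
    rw [add_sub_cancel] at hnhds
    refine mem_of_superset hnhds ?_
    rintro _ ⟨w', hw', rfl⟩
    exact IsDescentReachable.step hw' (by simp [hfst]) (by simpa using hsnd)

theorem periodic_isDescentReachable (h : IsTwistHomeo T) :
    Function.Periodic (IsDescentReachable T) (1, 0) := fun z =>
  propext ⟨fun hz => by simpa [add_assoc, Prod.mk_zero_zero] using hz.add_int_left h (-1),
    fun hz => by simpa using hz.add_int_left h 1⟩

/-- Truncating the last step of a long descent to a translate of its first position gives the
supersolution required by `exists_iterate_eq_add`. -/
theorem exists_iterate_eq_add_of_unbounded (h : IsTwistHomeo T) (hd : IsDriftFree T) {k : ℤ}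
    (hk : 0 ≤ k) (hunb : ∀ B : ℝ, ∃ z, IsDescentReachable T z ∧ B ≤ z.2) :
    ∃ (M : ℕ) (s : ℤ) (z : ℝ × ℝ), T^[M + 1] z = z + ((s : ℝ), (k : ℝ)) := by
  obtain ⟨C, hC⟩ := h.exists_abs_momIn_sub_le
  have hC₀ : 0 ≤ C := (abs_nonneg _).trans (hC 0 0)
  have hk₀ : (0 : ℝ) ≤ k := Int.cast_nonneg hk
  obtain ⟨z, hz, hzB⟩ := hunb (k + 2 * C + 1)
  obtain ⟨M, v, -, hv, hstart, harrive⟩ := hz.exists_isSuperorbit h (by linarith)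
  obtain ⟨s, hs⟩ : ∃ s : ℤ, s = ⌊v (M + 1) - v 0⌋ := ⟨_, rfl⟩
  have hfloor := Int.floor_eq_iff.1 hs.symm
  obtain ⟨w, hw₁, hw₂⟩ := h.exists_iterate_snd_le hd M s
  let v' := Function.update v (M + 1) (v 0 + s)
  have hinit {i : ℕ} (hi : i ≤ M) : v' i = v i := Function.update_of_ne (by lia) _ _
  have hlast : v' (M + 1) = v 0 + s := Function.update_self ..
  have hle : v' ≤ v := update_le_self_iff.2 (by linarith)
  refine ⟨M, s, h.exists_iterate_eq_add hk hw₁ hw₂ (v := v') (fun j hj => ?_) ?_ ?_⟩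
  · rw [hinit (i := j + 1) hj, hinit hj.le]
    exact ((h.strictMono_momOut _).monotone (hle _)).trans (hv j hj)
  · rw [hlast, hinit (Nat.zero_le M)]
  · rw [hinit (Nat.zero_le M), hinit le_rfl, hlast]
    have hOut := (h.strictMono_momOut (v 0)).monotone (hle 1)
    have hIn := abs_le.1 (hC (v M) (v (M + 1)))
    have hIn' := abs_le.1 (hC (v M) (v 0 + s))
    linarith

end IsTwistHomeo

/-! ### Invariant graphs -/

/-- A region below a closed curve of the cylinder, given by its lift `U`, that `T` maps into
itself. -/
structure IsTrappingRegion (T : ℝ × ℝ → ℝ × ℝ) (U : Set (ℝ × ℝ)) : Prop where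
  isOpen : IsOpen U
  periodic : Function.Periodic (· ∈ U) (1, 0)
  mem_of_le : ∀ z ∈ U, ∀ I ≤ z.2, (z.1, I) ∈ U
  exists_bound : ∃ B, (∀ z : ℝ × ℝ, z.2 < -B → z ∈ U) ∧ ∀ z ∈ U, z.2 < B
  mapsTo : Set.MapsTo T U U

/-- The height of the region `U` over `x`. -/
def regionHeight (U : Set (ℝ × ℝ)) (x : ℝ) : ℝ := sSup {I | (x, I) ∈ U}

namespace IsTrappingRegion

variable {T : ℝ × ℝ → ℝ × ℝ} {U : Set (ℝ × ℝ)} {ε : ℝ}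

theorem mem_iff (hU : IsTrappingRegion T U) {z : ℝ × ℝ} : z ∈ U ↔ z.2 < regionHeight U z.1 := by
  obtain ⟨B, hlow, hup⟩ := hU.exists_bound
  have hopen : IsOpen {I | (z.1, I) ∈ U} := hU.isOpen.preimage (by fun_prop)
  have hle : {I | (z.1, I) ∈ U} ⊆ Set.Iic (regionHeight U z.1) :=
    fun I hI => le_csSup ⟨B, fun J hJ => (hup _ hJ).le⟩ hI
  have hlt : {I | (z.1, I) ∈ U} ⊆ Set.Iio (regionHeight U z.1) :=
    interior_Iic (a := regionHeight U z.1) ▸ interior_maximal hle hopen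
  refine ⟨fun hz => hlt hz, fun hz => ?_⟩
  obtain ⟨J, hJ, hzJ⟩ := exists_lt_of_lt_csSup ⟨-B - 1, hlow (z.1, -B - 1) (by simp)⟩ hz
  exact hU.mem_of_le _ hJ _ hzJ.le

theorem periodic_regionHeight (hU : IsTrappingRegion T U) :
    Function.Periodic (regionHeight U) 1 := fun x => by
  have hslice (I : ℝ) : ((x + 1, I) ∈ U) = ((x, I) ∈ U) := by simpa using hU.periodic (x, I)
  simp only [regionHeight, hslice]

theorem subset_closure_image (hU : IsTrappingRegion T U) (hd : IsDriftFree T) :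
    U ⊆ closure (T '' U) := by
  obtain ⟨B, hlow, hup⟩ := hU.exists_bound
  have hempty := hd 1 U B hU.isOpen.measurableSet hU.periodic hlow hup
    (.inl (Set.mapsTo_iff_image_subset.1 hU.mapsTo))
  rw [Function.iterate_one] at hempty
  have hsub : U \ closure (T '' U) ⊆ interior (symmDiff (T '' U) U) :=
    interior_maximal (fun z hz => .inr ⟨hz.1, fun hz' => hz.2 (subset_closure hz')⟩)
      (hU.isOpen.sdiff isClosed_closure)
  exact Set.sdiff_eq_empty.1 (Set.subset_eq_empty hsub hempty)

theorem mem_closure_of_apply_mem (hU : IsTrappingRegion T U) (h : IsTwistHomeo T)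
    (hd : IsDriftFree T) {z : ℝ × ℝ} (hz : T z ∈ U) : z ∈ closure U := by
  have hpre := h.isHomeomorph.isOpenMap.preimage_closure_subset_closure_preimage
    (hU.subset_closure_image hd hz)
  rwa [h.injective.preimage_image] at hpre

theorem eventually_regionHeight_le_add_right (hU : IsTrappingRegion T U) (h : IsTwistHomeo T)
    (hd : IsDriftFree T) (x : ℝ) (hε : 0 < ε) :
    ∀ᶠ y in 𝓝[>] x, regionHeight U y ≤ regionHeight U x + ε := by
  obtain ⟨δ, hδ, huc⟩ := Metric.uniformContinuous_iff.1 h.uniformContinuous_momIn (ε / 2)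
    (by linarith)
  filter_upwards [Ioo_mem_nhdsGT (lt_add_of_pos_right x hδ)] with y hy
  have hyU : (y, regionHeight U y - ε / 4) ∈ U := hU.mem_iff.2 (by dsimp only; linarith)
  obtain ⟨_, ⟨⟨hq₁, hq₁'⟩, hq₂⟩, q, hq, rfl⟩ := mem_closure_iff.1
    (hU.subset_closure_image hd hyU) (Set.Ioo x (x + δ) ×ˢ Set.Ioi (regionHeight U y - ε / 2))
    (isOpen_Ioo.prod isOpen_Ioi) ⟨hy, by simp only [Set.mem_Ioi]; linarith⟩
  have hxU : (x, momIn T q.1 x) ∈ U := by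
    rw [← h.apply_momOut]
    refine hU.mapsTo (hU.mem_of_le q hq _ ?_)
    rw [← h.momOut_fst q]
    exact (h.strictMono_momOut q.1).monotone hq₁.le
  have hx : momIn T q.1 x < regionHeight U x := hU.mem_iff.1 hxU
  have hdist : dist (momIn T q.1 x) (T q).2 < ε / 2 := by
    rw [← h.momIn_fst q]
    refine huc (a := (q.1, x)) (b := (q.1, (T q).1)) ?_
    rw [Prod.dist_eq, dist_self, Real.dist_eq, abs_sub_comm, abs_of_pos (sub_pos.2 hq₁)]
    exact max_lt hδ (sub_lt_iff_lt_add'.2 hq₁')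
  have hq₂ : regionHeight U y - ε / 2 < (T q).2 := hq₂
  linarith [(abs_lt.1 hdist).1]

theorem eventually_regionHeight_le_add_left (hU : IsTrappingRegion T U) (h : IsTwistHomeo T)
    (hd : IsDriftFree T) (x : ℝ) (hε : 0 < ε) :
    ∀ᶠ y in 𝓝[<] x, regionHeight U y ≤ regionHeight U x + ε := by
  let I := regionHeight U x + ε / 2
  have hnot_mem : ∀ᶠ x₁ in 𝓝[>] x, (x₁, I) ∉ closure U := by
    filter_upwards [eventually_eventually_nhdsWithin.2
      (hU.eventually_regionHeight_le_add_right h hd x (by linarith : 0 < ε / 4)),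
      self_mem_nhdsWithin] with x₁ hright hx₁ hmem
    rw [isOpen_Ioi.nhdsWithin_eq hx₁] at hright
    have hI : ∀ᶠ J in 𝓝 I, regionHeight U x + ε / 4 < J :=
      lt_mem_nhds (by simp only [I]; linarith)
    obtain ⟨z, hzU, hz₁, hz₂⟩ :=
      ((mem_closure_iff_frequently.1 hmem).and_eventually (hright.prod_nhds hI)).exists
    linarith [hU.mem_iff.1 hzU]
  have hOut := h.continuous_momOut
  have hT := h.continuous
  have hnear : ∀ᶠ x₁ in 𝓝[>] x, momOut T x (T (x₁, I)).1 < regionHeight U x + ε := by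
    have hcont : Continuous fun x₁ => momOut T x (T (x₁, I)).1 := by fun_prop
    have hx : momOut T x (T (x, I)).1 < regionHeight U x + ε := by
      rw [h.momOut_fst (x, I)]
      simp only [I]
      linarith
    exact nhdsWithin_le_nhds (hcont.continuousAt.eventually (gt_mem_nhds hx))
  obtain ⟨x₁, hx₁U, hx₁, hxx₁⟩ := (hnot_mem.and (hnear.and self_mem_nhdsWithin)).exists
  have hcont : Continuous fun y => momOut T y (T (x₁, I)).1 := by fun_prop
  filter_upwards [nhdsWithin_le_nhds (hcont.continuousAt.eventually (gt_mem_nhds hx₁)),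
    self_mem_nhdsWithin] with y hy hyx
  refine le_of_not_gt fun hy' => hx₁U (hU.mem_closure_of_apply_mem h hd ?_)
  have hmem := hU.mapsTo (hU.mem_iff (z := (y, momOut T y (T (x₁, I)).1)).2 (hy.trans hy'))
  rw [h.apply_momOut] at hmem
  refine hU.mem_of_le _ hmem _ ?_
  rw [← h.momIn_fst (x₁, I)]
  exact (h.strictAnti_momIn _).antitone (hyx.trans hxx₁).le

theorem continuous_regionHeight (hU : IsTrappingRegion T U) (h : IsTwistHomeo T)
    (hd : IsDriftFree T) : Continuous (regionHeight U) := by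
  refine continuous_iff_lower_upperSemicontinuous.2 ⟨?_, fun x c hc => ?_⟩
  · refine lowerSemicontinuous_iff_isOpen_preimage.2 fun c => ?_
    have hpre : regionHeight U ⁻¹' Set.Ioi c = {x | (x, c) ∈ U} :=
      Set.ext fun x => (hU.mem_iff (z := (x, c))).symm
    rw [hpre]
    exact hU.isOpen.preimage (by fun_prop)
  · have hε : 0 < (c - regionHeight U x) / 2 := by linarith
    rw [← nhdsLT_sup_nhdsGE, ← Set.Ioi_union_left, nhdsWithin_union, nhdsWithin_singleton]
    refine eventually_sup.2 ⟨?_, eventually_sup.2 ⟨?_, hc⟩⟩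
    · filter_upwards [hU.eventually_regionHeight_le_add_left h hd x hε] with y hy
      linarith
    · filter_upwards [hU.eventually_regionHeight_le_add_right h hd x hε] with y hy
      linarith

theorem closure_eq (hU : IsTrappingRegion T U) (h : IsTwistHomeo T) (hd : IsDriftFree T) :
    closure U = {z | z.2 ≤ regionHeight U z.1} := by
  have hc := hU.continuous_regionHeight h hd
  refine subset_antisymm (closure_minimal (fun z hz => (hU.mem_iff.1 hz).le)
    (isClosed_le (f := Prod.snd) (by fun_prop) (by fun_prop))) fun z hz => ?_
  refine map_mem_closure (s := Set.Iio (regionHeight U z.1)) (f := fun I => (z.1, I))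
    (by fun_prop) ?_ fun I hI => hU.mem_iff.2 hI
  rwa [closure_Iio]

theorem image_eq (hU : IsTrappingRegion T U) (h : IsTwistHomeo T) (hd : IsDriftFree T) :
    T '' U = U := by
  refine subset_antisymm (Set.mapsTo_iff_image_subset.1 hU.mapsTo) fun w hw => ?_
  obtain ⟨z, rfl⟩ := h.isHomeomorph.surjective w
  refine ⟨z, hU.mem_iff.2 ?_, rfl⟩
  have hsub : {I | T (z.1, I) ∈ U} ⊆ Set.Iic (regionHeight U z.1) := fun I hI => by
    have hmem := hU.mem_closure_of_apply_mem h hd hI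
    rwa [hU.closure_eq h hd] at hmem
  have hT := h.continuous
  have hz := interior_maximal hsub (hU.isOpen.preimage (by fun_prop))
    (show T (z.1, z.2) ∈ U from hw)
  rwa [interior_Iic] at hz

theorem image_graph_regionHeight (hU : IsTrappingRegion T U) (h : IsTwistHomeo T)
    (hd : IsDriftFree T) :
    T '' {z | z.2 = regionHeight U z.1} = {z | z.2 = regionHeight U z.1} := by
  have hgraph : {z : ℝ × ℝ | z.2 = regionHeight U z.1} = frontier U := by
    rw [hU.isOpen.frontier_eq, hU.closure_eq h hd]
    ext z
    simp only [Set.mem_ofPred_eq, Set.mem_sdiff, hU.mem_iff, not_lt]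
    exact le_antisymm_iff
  have himage : T '' frontier U = frontier (T '' U) :=
    (h.isHomeomorph.homeomorph T).image_frontier U
  rw [hgraph, himage, hU.image_eq h hd]

end IsTrappingRegion

namespace IsTwistHomeo

variable {T : ℝ × ℝ → ℝ × ℝ}

theorem isTrappingRegion_isDescentReachable (h : IsTwistHomeo T) {B : ℝ}
    (hB : ∀ z, IsDescentReachable T z → z.2 < B) :
    IsTrappingRegion T {z | IsDescentReachable T z} where
  isOpen := h.isOpen_isDescentReachable
  periodic := h.periodic_isDescentReachable
  mem_of_le _ hz _ := hz.of_le
  exists_bound := ⟨max B 0, fun _ hz => .of_snd_neg (hz.trans_le (by simp)),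
    fun z hz => (hB z hz).trans_le (le_max_left _ _)⟩
  mapsTo _ hz := IsDescentReachable.step hz rfl le_rfl

theorem exists_invariant_graph_or_exists_iterate_eq_add_of_nonneg (h : IsTwistHomeo T)
    (hd : IsDriftFree T) {k : ℤ} (hk : 0 ≤ k) :
    (∃ u : ℝ → ℝ, Continuous u ∧ Function.Periodic u 1 ∧
      T '' {z | z.2 = u z.1} = {z | z.2 = u z.1}) ∨
    ∃ (M : ℕ) (s : ℤ) (z : ℝ × ℝ), T^[M + 1] z = z + ((s : ℝ), (k : ℝ)) := by
  by_cases hB : ∃ B : ℝ, ∀ z, IsDescentReachable T z → z.2 < B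
  · obtain ⟨B, hB⟩ := hB
    have hU := h.isTrappingRegion_isDescentReachable hB
    exact .inl ⟨_, hU.continuous_regionHeight h hd, hU.periodic_regionHeight,
      hU.image_graph_regionHeight h hd⟩
  · push Not at hB
    exact .inr (h.exists_iterate_eq_add_of_unbounded hd hk hB)

end IsTwistHomeo

section Neg

variable {T : ℝ × ℝ → ℝ × ℝ}

theorem iterate_neg_comp_neg (T : ℝ × ℝ → ℝ × ℝ) (n : ℕ) (z : ℝ × ℝ) :
    (fun z => -T (-z))^[n] z = -T^[n] (-z) := by
  induction n with
  | zero => simp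
  | succ n ih => rw [Function.iterate_succ_apply', ih, Function.iterate_succ_apply', neg_neg]

namespace IsTwistHomeo

theorem neg (h : IsTwistHomeo T) : IsTwistHomeo fun z => -T (-z) where
  isHomeomorph :=
    (Homeomorph.neg _).isHomeomorph.comp (h.isHomeomorph.comp (Homeomorph.neg _).isHomeomorph)
  map_add_left z := by
    have hstep := h.map_add_left (-(z + (1, 0)))
    rw [neg_add, neg_add_cancel_right] at hstep
    rw [neg_add, hstep, neg_add, neg_add_cancel_right]
  map_add_right z := by
    have hstep := h.map_add_right (-(z + (0, 1)))
    rw [neg_add, neg_add_cancel_right] at hstep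
    rw [neg_add, hstep, neg_add, neg_add_cancel_right]
  strictMono_fst x I J hIJ := by simpa using h.strictMono_fst (-x) (neg_lt_neg hIJ)

end IsTwistHomeo

theorem IsDriftFree.neg (hd : IsDriftFree T) (h : IsTwistHomeo T) :
    IsDriftFree fun z => -T (-z) := by
  intro n V B hV hper hlow hup hmono
  have himage : T^[n] '' (Neg.neg ⁻¹' V)ᶜ = (Neg.neg ⁻¹' ((fun z => -T (-z))^[n] '' V))ᶜ := by
    rw [Set.image_compl_eq (isHomeomorph_iterate h.isHomeomorph n).bijective]
    congr 1
    ext z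
    constructor
    · rintro ⟨w, hw, rfl⟩
      exact ⟨-w, hw, by rw [iterate_neg_comp_neg, neg_neg]⟩
    · rintro ⟨w, hw, hwz⟩
      rw [iterate_neg_comp_neg, neg_inj] at hwz
      exact ⟨-w, by simpa using hw, hwz⟩
  have hempty := hd n (Neg.neg ⁻¹' V)ᶜ (B + 1) (measurable_neg hV).compl (fun z => ?_)
    (fun z hz hzV => ?_) (fun z hz => not_le.1 fun hz' => hz (hlow _ ?_)) ?_
  · have hinterior := (Homeomorph.neg (ℝ × ℝ)).preimage_interior
      (symmDiff ((fun z => -T (-z))^[n] '' V) V)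
    rw [himage, compl_symmDiff_compl, ← Set.preimage_symmDiff] at hempty
    exact Set.preimage_injective.2 neg_surjective (hinterior.trans hempty)
  · simp only [Set.mem_compl_iff, Set.mem_preimage, neg_add', hper.sub_eq]
  · have hz' : -z.2 < B := hup _ hzV
    linarith
  · simp only [Prod.snd_neg]
    linarith
  · rw [himage, Set.compl_subset_compl, Set.compl_subset_compl]
    exact hmono.symm.imp (Set.preimage_mono ·) (Set.preimage_mono ·)

theorem IsTwistHomeo.exists_invariant_graph_or_exists_iterate_eq_add (h : IsTwistHomeo T)
    (hd : IsDriftFree T) (k : ℤ) :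
    (∃ u : ℝ → ℝ, Continuous u ∧ Function.Periodic u 1 ∧
      T '' {z | z.2 = u z.1} = {z | z.2 = u z.1}) ∨
    ∃ (M : ℕ) (s : ℤ) (z : ℝ × ℝ), T^[M + 1] z = z + ((s : ℝ), (k : ℝ)) := by
  rcases le_total 0 k with hk | hk
  · exact h.exists_invariant_graph_or_exists_iterate_eq_add_of_nonneg hd hk
  rcases h.neg.exists_invariant_graph_or_exists_iterate_eq_add_of_nonneg (hd.neg h)
    (neg_nonneg.2 hk) with ⟨u, hu, hper, hinv⟩ | ⟨M, s, z, hz⟩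
  · have hgraph : {z : ℝ × ℝ | z.2 = -u (-z.1)} = Neg.neg '' {z : ℝ × ℝ | z.2 = u z.1} := by
      rw [Set.image_neg_eq_neg]
      ext z
      simp [neg_eq_iff_eq_neg]
    refine .inl ⟨fun x => -u (-x), by fun_prop, fun x => ?_, ?_⟩
    · simp only [neg_add', hper.sub_eq]
    · have hcomp : T ∘ Neg.neg = Neg.neg ∘ fun z => -T (-z) := by
        ext z <;> simp
      rw [hgraph, ← Set.image_comp, hcomp, Set.image_comp, hinv]
  · refine .inr ⟨M, -s, -z, ?_⟩
    rw [iterate_neg_comp_neg, neg_eq_iff_eq_neg] at hz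
    rw [hz]
    ext <;> simp [add_comm]

end Neg

/-! ### Exact maps are drift-free -/

section MeasureExcess

variable {X : Type*} [MeasurableSpace X] {μ : Measure X} {s t u : Set X}

/-- The difference of the measures of `s` and `t`, in a form that makes sense for sets of infinite
measure as long as `symmDiff s t` has finite measure. -/
def measureExcess (μ : Measure X) (s t : Set X) : ℝ := μ.real (s \ t) - μ.real (t \ s)

theorem measureExcess_comm : measureExcess μ s t = -measureExcess μ t s :=
  (neg_sub _ _).symm

theorem measureExcess_eq_zero_iff_of_subset_or_subset (hst : μ (symmDiff s t) ≠ ⊤)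
    (hsub : s ⊆ t ∨ t ⊆ s) : measureExcess μ s t = 0 ↔ μ (symmDiff s t) = 0 := by
  rw [← measureReal_eq_zero_iff hst]
  rcases hsub with hsub | hsub
  · simp [measureExcess, Set.sdiff_eq_empty.2 hsub, symmDiff_of_le hsub]
  · simp [measureExcess, Set.sdiff_eq_empty.2 hsub, symmDiff_of_ge hsub]

theorem measure_symmDiff_ne_top_trans (hst : μ (symmDiff s t) ≠ ⊤) (htu : μ (symmDiff t u) ≠ ⊤) :
    μ (symmDiff s u) ≠ ⊤ :=
  ne_top_of_le_ne_top (ENNReal.add_ne_top.2 ⟨hst, htu⟩) (measure_symmDiff_le s t u)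

theorem measureExcess_add_measureExcess (hs : MeasurableSet s) (ht : MeasurableSet t)
    (hu : MeasurableSet u) (hst : μ (symmDiff s t) ≠ ⊤) (htu : μ (symmDiff t u) ≠ ⊤) :
    measureExcess μ s t + measureExcess μ t u = measureExcess μ s u := by
  have split (a b c : Set X) (hc : MeasurableSet c) (hab : μ (symmDiff a b) ≠ ⊤) :
      μ.real (a \ b) = μ.real ((a ∩ c) \ b) + μ.real (a \ (b ∪ c)) := by
    rw [← measureReal_inter_add_sdiff hc (measure_ne_top_of_subset le_sup_left hab),
      Set.sdiff_sdiff, Set.inter_sdiff_right_comm]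
  have hsu := measure_symmDiff_ne_top_trans hst htu
  unfold measureExcess
  rw [split s t u hu hst, split t s u hu (symmDiff_comm s t ▸ hst), split t u s hs htu,
    split u t s hs (symmDiff_comm t u ▸ htu), split s u t ht hsu,
    split u s t ht (symmDiff_comm s u ▸ hsu), Set.inter_comm t s, Set.inter_comm u s,
    Set.inter_comm u t, Set.union_comm u s, Set.union_comm t s, Set.union_comm u t]
  ring

variable {F : X → X}

theorem measure_image_of_measurePreserving (hF : MeasurePreserving F μ μ)
    (hFe : MeasurableEmbedding F) (s : Set X) : μ (F '' s) = μ s := by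
  rw [← hF.measure_preimage_emb hFe, hFe.injective.preimage_image]

theorem measure_symmDiff_image (hF : MeasurePreserving F μ μ) (hFe : MeasurableEmbedding F)
    (s t : Set X) : μ (symmDiff (F '' s) (F '' t)) = μ (symmDiff s t) := by
  rw [← Set.image_symmDiff hFe.injective, measure_image_of_measurePreserving hF hFe]

theorem measureExcess_image (hF : MeasurePreserving F μ μ) (hFe : MeasurableEmbedding F)
    (s t : Set X) : measureExcess μ (F '' s) (F '' t) = measureExcess μ s t := by
  simp only [measureExcess, Measure.real, ← Set.image_sdiff hFe.injective,
    measure_image_of_measurePreserving hF hFe]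

theorem measure_symmDiff_image_self_ne_top (hF : MeasurePreserving F μ μ)
    (hFe : MeasurableEmbedding F) (hst : μ (symmDiff s t) ≠ ⊤)
    (hFt : μ (symmDiff (F '' t) t) ≠ ⊤) : μ (symmDiff (F '' s) s) ≠ ⊤ :=
  measure_symmDiff_ne_top_trans ((measure_symmDiff_image hF hFe s t).trans_ne hst)
    (measure_symmDiff_ne_top_trans hFt (symmDiff_comm s t ▸ hst))

theorem measureExcess_image_self_eq (hF : MeasurePreserving F μ μ) (hFe : MeasurableEmbedding F)
    (hs : MeasurableSet s) (ht : MeasurableSet t) (hst : μ (symmDiff s t) ≠ ⊤)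
    (hFt : μ (symmDiff (F '' t) t) ≠ ⊤) :
    measureExcess μ (F '' s) s = measureExcess μ (F '' t) t := by
  have hFst := (measure_symmDiff_image hF hFe s t).trans_ne hst
  have hts : μ (symmDiff t s) ≠ ⊤ := symmDiff_comm s t ▸ hst
  rw [← measureExcess_add_measureExcess (hFe.measurableSet_image.2 hs)
      (hFe.measurableSet_image.2 ht) hs hFst (measure_symmDiff_ne_top_trans hFt hts),
    ← measureExcess_add_measureExcess (hFe.measurableSet_image.2 ht) ht hs hFt hts,
    measureExcess_image hF hFe, measureExcess_comm (s := s)]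
  ring

theorem measurableEmbedding_iterate (hFe : MeasurableEmbedding F) (n : ℕ) :
    MeasurableEmbedding F^[n] := by
  induction n with
  | zero => exact .id
  | succ n ih => exact ih.comp hFe

theorem measureExcess_image_iterate_eq_zero (hF : MeasurePreserving F μ μ)
    (hFe : MeasurableEmbedding F) (ht : MeasurableSet t) (hFt : μ (symmDiff (F '' t) t) ≠ ⊤)
    (hzero : measureExcess μ (F '' t) t = 0) (n : ℕ) :
    μ (symmDiff (F^[n] '' t) t) ≠ ⊤ ∧ measureExcess μ (F^[n] '' t) t = 0 := by
  induction n with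
  | zero => simp [measureExcess]
  | succ n ih =>
    obtain ⟨hfin, hn⟩ := ih
    have hmeas := (measurableEmbedding_iterate hFe n).measurableSet_image.2 ht
    have hstep := measure_symmDiff_image_self_ne_top hF hFe hfin hFt
    rw [Function.iterate_succ', Set.image_comp]
    refine ⟨measure_symmDiff_ne_top_trans hstep hfin, ?_⟩
    rw [← measureExcess_add_measureExcess (hFe.measurableSet_image.2 hmeas) hmeas ht hstep hfin,
      measureExcess_image_self_eq hF hFe hmeas ht hfin hFt, hzero, hn, add_zero]

/-- The net flux of `F^[n]` is the same through `s` as through `t`, and the net flux through `t` is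
additive in the number of iterations. -/
theorem measure_symmDiff_image_iterate_eq_zero (hF : MeasurePreserving F μ μ)
    (hFe : MeasurableEmbedding F) (hs : MeasurableSet s) (ht : MeasurableSet t)
    (hst : μ (symmDiff s t) ≠ ⊤) (hFt : μ (symmDiff (F '' t) t) ≠ ⊤)
    (hzero : measureExcess μ (F '' t) t = 0) {n : ℕ} (hsub : F^[n] '' s ⊆ s ∨ s ⊆ F^[n] '' s) :
    μ (symmDiff (F^[n] '' s) s) = 0 := by
  obtain ⟨hfin, hn⟩ := measureExcess_image_iterate_eq_zero hF hFe ht hFt hzero n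
  have hFn := hF.iterate n
  have hFne := measurableEmbedding_iterate hFe n
  rw [← measureExcess_eq_zero_iff_of_subset_or_subset
      (measure_symmDiff_image_self_ne_top hFn hFne hst hfin) hsub,
    measureExcess_image_self_eq hFn hFne hs ht hst hfin, hn]

end MeasureExcess

/-- Makes the lower half of the cylinder one of the regions through which `IsMuExact` requires zero
flux. -/
def lowerHalfHomeomorph : {x : Cylinder | x.2 < 0} ≃ₜ Cylinder where
  toFun x := (x.1.1, Real.log (-x.1.2))
  invFun y := ⟨(y.1, -Real.exp y.2), by simpa using Real.exp_pos y.2⟩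
  left_inv := by
    rintro ⟨⟨x, I⟩, hI : I < 0⟩
    ext <;> simp [Real.exp_log_of_neg hI]
  right_inv := by
    rintro ⟨x, I⟩
    simp
  continuous_toFun := by
    refine (continuous_fst.comp continuous_subtype_val).prodMk (Continuous.log (by fun_prop) ?_)
    rintro ⟨⟨x, I⟩, hI : I < 0⟩
    exact (neg_pos.2 hI).ne'
  continuous_invFun := by fun_prop

theorem IsMuExact.flux_lowerHalf {μ : Measure Cylinder} {F : Cylinder → Cylinder}
    (h : IsMuExact μ F) :
    μ (F '' {x | x.2 < 0} \ {x | x.2 < 0}) = μ ({x | x.2 < 0} \ F '' {x | x.2 < 0}) := by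
  refine h.flux _ (isOpen_lt continuous_snd continuous_const) ⟨lowerHalfHomeomorph⟩ ?_
  have hcompact : IsCompact (Set.univ ×ˢ {0} : Set Cylinder) :=
    isCompact_univ.prod isCompact_singleton
  refine hcompact.of_isClosed_subset isClosed_frontier fun x hx => ⟨trivial, ?_⟩
  exact frontier_lt_subset_eq continuous_snd continuous_const hx

theorem measure_symmDiff_lowerHalf_ne_top {μ : Measure Cylinder} [IsLocallyFiniteMeasure μ]
    {W : Set Cylinder} {B : ℝ} (hlow : ∀ x : Cylinder, x.2 < -B → x ∈ W)
    (hup : ∀ x ∈ W, x.2 < B) : μ (symmDiff W {x | x.2 < 0}) ≠ ⊤ := by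
  have hcompact : IsCompact (Set.univ ×ˢ Set.Icc (-B) B : Set Cylinder) :=
    isCompact_univ.prod isCompact_Icc
  refine measure_ne_top_of_subset ?_ hcompact.measure_lt_top.ne
  rintro x (⟨hxW, hx⟩ | ⟨hx, hxW⟩)
  · have h0 : 0 ≤ x.2 := not_lt.1 hx
    have hB := hup x hxW
    exact ⟨trivial, by linarith, hB.le⟩
  · have h0 : x.2 < 0 := hx
    have hB : -B ≤ x.2 := not_lt.1 fun hlt => hxW (hlow x hlt)
    exact ⟨trivial, hB, by linarith⟩

theorem cylProj_circleRep (x : Cylinder) : cylProj (circleRep x.1, x.2) = x :=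
  Prod.ext (coe_circleRep x.1) rfl

theorem measurable_circleRep : Measurable circleRep :=
  measurable_subtype_coe.comp (AddCircle.measurableEquivIco (1 : ℝ) 0).measurable

theorem exists_preimage_cylProj_eq {V : Set (ℝ × ℝ)} (hV : MeasurableSet V)
    (hper : Function.Periodic (· ∈ V) (1, 0)) :
    ∃ W : Set Cylinder, MeasurableSet W ∧ cylProj ⁻¹' W = V := by
  refine ⟨(fun x => (circleRep x.1, x.2)) ⁻¹' V,
    ((measurable_circleRep.comp measurable_fst).prodMk measurable_snd) hV, ?_⟩
  ext z
  obtain ⟨m, hm⟩ := cylProj_eq_cylProj_iff.1 (cylProj_circleRep (cylProj z)).symm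
  simpa only [Set.mem_preimage, hm] using iff_of_eq (map_add_int_left_of_periodic hper z m)

namespace IsTwistHomeo

variable {T : ℝ × ℝ → ℝ × ℝ}

theorem inducedCylMap_cylProj (h : IsTwistHomeo T) (z : ℝ × ℝ) :
    inducedCylMap T (cylProj z) = cylProj (T z) := by
  obtain ⟨m, hm⟩ := cylProj_eq_cylProj_iff.1 (cylProj_circleRep (cylProj z)).symm
  have hT := h.map_add_int z m 0
  rw [Int.cast_zero, add_zero] at hT
  exact (cylProj_eq_cylProj_iff.2 ⟨m, by rw [hm, hT]⟩).symm

theorem semiconj_cylProj_iterate (h : IsTwistHomeo T) (n : ℕ) :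
    Function.Semiconj cylProj T^[n] (inducedCylMap T)^[n] :=
  Function.Semiconj.iterate_right (fun z => (h.inducedCylMap_cylProj z).symm) n

theorem isHomeomorph_inducedCylMap (h : IsTwistHomeo T) : IsHomeomorph (inducedCylMap T) := by
  have hq := isOpenQuotientMap_cylProj
  have hcomp : inducedCylMap T ∘ cylProj = cylProj ∘ T := funext h.inducedCylMap_cylProj
  have hqT : IsOpenQuotientMap (inducedCylMap T ∘ cylProj) :=
    hcomp ▸ hq.comp ⟨h.isHomeomorph.surjective, h.continuous, h.isHomeomorph.isOpenMap⟩
  refine ⟨hq.isQuotientMap.continuous_iff.2 hqT.continuous, fun U hU => ?_, fun x y hxy => ?_,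
    hqT.surjective.of_comp⟩
  · rw [← hq.surjective.image_preimage U, ← Set.image_comp]
    exact hqT.isOpenMap _ (hU.preimage hq.continuous)
  · obtain ⟨z, rfl⟩ := hq.surjective x
    obtain ⟨w, rfl⟩ := hq.surjective y
    rw [h.inducedCylMap_cylProj, h.inducedCylMap_cylProj, cylProj_eq_cylProj_iff] at hxy
    obtain ⟨m, hm⟩ := hxy
    have hT := h.map_add_int z m 0
    rw [Int.cast_zero, add_zero, ← hm] at hT
    exact cylProj_eq_cylProj_iff.2 ⟨m, (h.injective hT).symm⟩

theorem preimage_cylProj_image_iterate (h : IsTwistHomeo T) (n : ℕ) (W : Set Cylinder) :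
    cylProj ⁻¹' ((inducedCylMap T)^[n] '' W) = T^[n] '' (cylProj ⁻¹' W) := by
  ext z
  constructor
  · rintro ⟨x, hx, hxz⟩
    obtain ⟨w, hw⟩ := (isHomeomorph_iterate h.isHomeomorph n).surjective z
    refine ⟨w, ?_, hw⟩
    rw [← hw, (h.semiconj_cylProj_iterate n).eq] at hxz
    rwa [Set.mem_preimage, ← (h.isHomeomorph_inducedCylMap.injective.iterate n) hxz]
  · rintro ⟨w, hw, rfl⟩
    exact ⟨cylProj w, hw, ((h.semiconj_cylProj_iterate n).eq w).symm⟩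

theorem exists_abs_inducedCylMap_snd_sub_le (h : IsTwistHomeo T) :
    ∃ C, ∀ x, |(inducedCylMap T x).2 - x.2| ≤ C := by
  obtain ⟨C, hC⟩ := h.exists_abs_iterate_snd_sub_le 1
  exact ⟨C, fun x => hC (circleRep x.1, x.2)⟩

theorem measure_symmDiff_image_lowerHalf_ne_top (h : IsTwistHomeo T) {μ : Measure Cylinder}
    [IsLocallyFiniteMeasure μ] :
    μ (symmDiff (inducedCylMap T '' {x | x.2 < 0}) {x | x.2 < 0}) ≠ ⊤ := by
  obtain ⟨C, hC⟩ := h.exists_abs_inducedCylMap_snd_sub_le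
  refine measure_symmDiff_lowerHalf_ne_top (B := C) (fun x hx => ?_) ?_
  · obtain ⟨y, rfl⟩ := h.isHomeomorph_inducedCylMap.surjective x
    exact ⟨y, show y.2 < 0 by linarith [neg_le_of_abs_le (hC y)], rfl⟩
  · rintro _ ⟨y, hy : y.2 < 0, rfl⟩
    linarith [le_of_abs_le (hC y)]

theorem isDriftFree (h : IsTwistHomeo T) {μ : Measure Cylinder} [IsLocallyFiniteMeasure μ]
    [μ.IsOpenPosMeasure] (hinv : MeasurePreserving (inducedCylMap T) μ μ)
    (hflux : μ (inducedCylMap T '' {x | x.2 < 0} \ {x | x.2 < 0}) =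
      μ ({x | x.2 < 0} \ inducedCylMap T '' {x | x.2 < 0})) : IsDriftFree T := by
  intro n V B hV hper hlow hup hsub
  obtain ⟨W, hW, rfl⟩ := exists_preimage_cylProj_eq hV hper
  have hsurj := isOpenQuotientMap_cylProj.surjective
  have hWlow : ∀ x : Cylinder, x.2 < -B → x ∈ W := fun x => by
    obtain ⟨z, rfl⟩ := hsurj x
    exact hlow z
  have hWup : ∀ x ∈ W, x.2 < B := fun x => by
    obtain ⟨z, rfl⟩ := hsurj x
    exact hup z
  simp only [← h.preimage_cylProj_image_iterate, hsurj.preimage_subset_preimage_iff] at hsub ⊢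
  have hnull := measure_symmDiff_image_iterate_eq_zero hinv
    h.isHomeomorph_inducedCylMap.homeomorph.measurableEmbedding hW
    (measurableSet_lt measurable_snd measurable_const)
    (measure_symmDiff_lowerHalf_ne_top hWlow hWup) h.measure_symmDiff_image_lowerHalf_ne_top
    (by simp only [measureExcess, Measure.real, hflux, sub_self]) hsub
  rw [← Set.preimage_symmDiff,
    ← isOpenQuotientMap_cylProj.isOpenMap.preimage_interior_eq_interior_preimage
      isOpenQuotientMap_cylProj.continuous, Measure.interior_eq_empty_of_null hnull,
    Set.preimage_empty]

end IsTwistHomeo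

/-! ### Invariant graphs are rotational invariant circles -/

theorem not_nullhomotopic_id_unitAddCircle :
    ¬ (ContinuousMap.id UnitAddCircle).Nullhomotopic := by
  intro hnull
  have : ContractibleSpace UnitAddCircle := (contractible_iff_id_nullhomotopic _).2 hnull
  have : LocallyPathConnectedSpace UnitAddCircle :=
    inferInstanceAs (LocallyPathConnectedSpace (Quotient _))
  have hcov := AddCircle.isCoveringMap_coe (1 : ℝ)
  obtain ⟨f, ⟨hf0, hf⟩, -⟩ :=
    hcov.existsUnique_continuousMap_lifts (ContinuousMap.id UnitAddCircle) 0 0 rfl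
  have hid : (f ∘ fun x : ℝ => (x : UnitAddCircle)) = id :=
    hcov.eq_of_comp_eq (by fun_prop) continuous_id
      (funext fun x => congrFun hf (x : UnitAddCircle)) 0 hf0
  have h1 : f ((1 : ℝ) : UnitAddCircle) = 1 := congrFun hid 1
  have hcoe : ((1 : ℝ) : UnitAddCircle) = 0 := AddCircle.coe_period 1
  rw [hcoe, hf0] at h1
  exact zero_ne_one h1

theorem IsTwistHomeo.exists_isRotationalInvariantCircle_of_graph {T : ℝ × ℝ → ℝ × ℝ}
    (h : IsTwistHomeo T) {u : ℝ → ℝ} (hu : Continuous u) (hper : Function.Periodic u 1)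
    (hinv : T '' {z | z.2 = u z.1} = {z | z.2 = u z.1}) :
    ∃ C, IsRotationalInvariantCircle T C := by
  have hlift : Continuous (hper.lift : UnitAddCircle → ℝ) :=
    QuotientAddGroup.isOpenQuotientMap_mk.continuous_comp_iff.1 hu
  let γ : C(UnitAddCircle, Cylinder) := ⟨fun x => (x, hper.lift x), by fun_prop⟩
  have hgraph : cylProj ⁻¹' Set.range γ = {z | z.2 = u z.1} := by
    ext z
    constructor
    · rintro ⟨x, hx⟩
      obtain ⟨rfl, h₂⟩ := Prod.ext_iff.1 hx
      exact h₂.symm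
    · exact fun hz => ⟨z.1, Prod.ext rfl (Eq.symm hz)⟩
  refine ⟨Set.range γ, ⟨γ, fun x y hxy => congrArg Prod.fst hxy, fun hnull => ?_, rfl⟩, ?_⟩
  · exact not_nullhomotopic_id_unitAddCircle (hnull.comp_right (ContinuousMap.fst))
  · refine isOpenQuotientMap_cylProj.surjective.preimage_injective ?_
    have himage := h.preimage_cylProj_image_iterate 1 (Set.range γ)
    simp only [Function.iterate_one] at himage
    rw [himage, hgraph, hinv]

/-! ### Rotation vectors of periodic orbits -/

theorem tendsto_periodic_div {p : ℕ → ℝ} {N : ℕ} (hN : N ≠ 0) (hp : Function.Periodic p N) :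
    Tendsto (fun n : ℕ => p n / n) atTop (𝓝 0) := by
  have hb (n) : |p n| ≤ ∑ i ∈ Finset.range N, |p i| := by
    rw [← hp.map_mod_nat n]
    exact Finset.single_le_sum (f := fun i => |p i|) (fun i _ => abs_nonneg _)
      (Finset.mem_range.2 (Nat.mod_lt n hN.pos))
  exact tendsto_bdd_div_atTop_nhds_zero (Eventually.of_forall fun n => neg_le_of_abs_le (hb n))
    (Eventually.of_forall fun n => le_of_abs_le (hb n)) tendsto_natCast_atTop_atTop

theorem tendsto_div_of_add_period {a : ℕ → ℝ} {N : ℕ} {c : ℝ} (hN : N ≠ 0)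
    (ha : ∀ n, a (n + N) = a n + c) : Tendsto (fun n : ℕ => a n / n) atTop (𝓝 (c / N)) := by
  have hN' : (N : ℝ) ≠ 0 := Nat.cast_ne_zero.2 hN
  have hper : Function.Periodic (fun n : ℕ => a n - c / N * n) N := fun n => by
    simp only [ha, Nat.cast_add]
    field_simp
    ring
  have hlim := (tendsto_periodic_div hN hper).const_add (c / N)
  rw [add_zero] at hlim
  refine hlim.congr' ?_
  filter_upwards [eventually_ne_atTop 0] with n hn
  field_simp
  ring

theorem tendsto_div_atTop_of_add_period {a : ℕ → ℝ} {N : ℕ} {b c : ℝ} (hN : N ≠ 0) (hc : 0 < c)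
    (ha : ∀ n : ℕ, a (n + N) = a n + (b + n * c)) : Tendsto (fun n : ℕ => a n / n) atTop atTop := by
  have hN' : (N : ℝ) ≠ 0 := Nat.cast_ne_zero.2 hN
  have hlinear : Tendsto (fun n : ℕ => (a n - c / (2 * N) * n ^ 2) / n) atTop
      (𝓝 ((b - c * N / 2) / N)) :=
    tendsto_div_of_add_period hN fun n => by
      rw [ha, Nat.cast_add]
      field_simp
      ring
  have hquadratic : Tendsto (fun n : ℕ => c / (2 * N) * n) atTop atTop :=
    tendsto_natCast_atTop_atTop.const_mul_atTop (by positivity)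
  refine (hquadratic.atTop_add hlinear).congr' ?_
  filter_upwards [eventually_ne_atTop 0] with n hn
  field_simp
  ring

theorem torusProj_circleRep (x : Torus) : torusProj (circleRep x.1, circleRep x.2) = x :=
  Prod.ext (coe_circleRep _) (coe_circleRep _)

namespace IsTwistHomeo

variable {T : ℝ × ℝ → ℝ × ℝ}

theorem hasRotationVector_of_iterate_eq_add (h : IsTwistHomeo T) {N : ℕ} (hN : N ≠ 0) {s k : ℤ}
    (hk : k ≠ 0) {z : ℝ × ℝ} (hz : T^[N] z = z + ((s : ℝ), (k : ℝ))) :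
    HasRotationVector T z (⊤, (((k : ℝ) / N : ℝ) : EReal)) ∨
      HasRotationVector T z (⊥, (((k : ℝ) / N : ℝ) : EReal)) := by
  have hstep (n) : T^[n + N] z = T^[n] z + ((s : ℝ) + n * k, (k : ℝ)) := by
    rw [Function.iterate_add_apply, hz, h.iterate_add_int]
  have hsnd := EReal.tendsto_coe.2 <| tendsto_div_of_add_period (c := k)
    (a := fun n => (T^[n] z).2 - z.2) hN fun n => by
      rw [hstep, Prod.snd_add]
      ring
  rcases lt_or_gt_of_ne hk with hk | hk
  · right
    have hfst := tendsto_div_atTop_of_add_period (b := -s) (c := -k)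
      (a := fun n => -((T^[n] z).1 - z.1)) hN (neg_pos.2 (Int.cast_lt_zero.2 hk)) fun n => by
        rw [hstep, Prod.fst_add]
        ring
    simp only [neg_div, tendsto_neg_atTop_iff] at hfst
    exact (EReal.tendsto_coe_nhds_bot_iff.2 hfst).prodMk_nhds hsnd
  · left
    have hfst := tendsto_div_atTop_of_add_period (b := s) (c := k)
      (a := fun n => (T^[n] z).1 - z.1) hN (Int.cast_pos.2 hk) fun n => by
        rw [hstep, Prod.fst_add]
        ring
    exact (EReal.tendsto_coe_nhds_top_iff.2 hfst).prodMk_nhds hsnd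

theorem semiconj_torusProj (h : IsTwistHomeo T) :
    Function.Semiconj torusProj T (inducedTorusMap T) := fun z => by
  obtain ⟨m, l, hz⟩ := torusProj_eq_torusProj_iff.1 (torusProj_circleRep (torusProj z))
  refine (torusProj_eq_torusProj_iff.2 ⟨m + l, l, ?_⟩).symm
  conv_lhs => rw [hz]
  rw [h.map_add_int, Int.cast_add]

theorem exists_isPeriodicOrbit_of_iterate_eq_add (h : IsTwistHomeo T) {N : ℕ} (hN : N ≠ 0)
    {s k : ℤ} (hk : k ≠ 0) {z : ℝ × ℝ} (hz : T^[N] z = z + ((s : ℝ), (k : ℝ))) :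
    ∃ O : Set Torus, IsPeriodicOrbit (inducedTorusMap T) O ∧
      HasVerticalRotationNumber T O ((k : ℝ) / (N : ℝ)) := by
  have hsemi (n) := (h.semiconj_torusProj.iterate_right n).eq z
  refine ⟨_, ⟨torusProj z, ⟨N, hN.pos, ?_⟩, rfl⟩, ?_⟩
  · exact (hsemi N).symm.trans (torusProj_eq_torusProj_iff.2 ⟨s, k, hz⟩).symm
  · rintro w ⟨j, hj⟩
    obtain ⟨m, l, rfl⟩ := torusProj_eq_torusProj_iff.1 ((hsemi j).trans hj)
    refine h.hasRotationVector_of_iterate_eq_add hN (s := s + j * k + N * l) hk ?_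
    rw [h.iterate_add_int, (Function.Commute.iterate_iterate_self T N j).eq, hz, h.iterate_add_int]
    push_cast
    ext <;> simp <;> ring

end IsTwistHomeo

/-! ### Essential closed curves separate the ends of the cylinder -/

/-- The cylinder as the punctured plane: `(φ, I)` is the point with argument `2πφ` and modulus
`exp I`. The two ends of the cylinder become `0` and infinity. -/
def cylinderHomeomorph : Cylinder ≃ₜ ({0}ᶜ : Set ℂ) :=
  ((AddCircle.homeomorphCircle one_ne_zero).prodCongr Real.expOrderIso.toHomeomorph).trans
    (homeomorphUnitSphereProd ℂ).symm

theorem norm_cylinderHomeomorph (x : Cylinder) : ‖(cylinderHomeomorph x : ℂ)‖ = Real.exp x.2 := by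
  rw [← homeomorphUnitSphereProd_apply_snd_coe]
  exact congrArg (fun y => (y.2 : ℝ)) ((homeomorphUnitSphereProd ℂ).apply_symm_apply _)

theorem homotopic_of_forall_mem {X E : Type*} [TopologicalSpace X] [TopologicalSpace E] {s : Set E}
    {f g : C(X, s)} {H : unitInterval × X → E} (hH : Continuous H) (hs : ∀ p, H p ∈ s)
    (h₀ : ∀ x, H (0, x) = f x) (h₁ : ∀ x, H (1, x) = g x) : f.Homotopic g :=
  ⟨⟨⟨fun p => ⟨H p, hs p⟩, by fun_prop⟩, fun x => Subtype.ext (h₀ x), fun x => Subtype.ext (h₁ x)⟩⟩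

/-- Look at `γ` from a moving point that never meets it: from `0` to `p` in a straight line, then to
`q` along the path. Seen from `q`, the curve can be contracted to `0`. -/
theorem nullhomotopic_of_joinedIn_compl_range {X E : Type*} [TopologicalSpace X] [Nonempty X]
    [NormedAddCommGroup E] [NormedSpace ℝ E] {γ : C(X, ({0}ᶜ : Set E))} {p q : E}
    (hpq : JoinedIn (Set.range fun x => (γ x : E))ᶜ p q) (hp : ∀ x, ‖p‖ < ‖(γ x : E)‖)
    (hq : ∀ x, ‖(γ x : E)‖ < ‖q‖) : γ.Nullhomotopic := by
  obtain ⟨α, hα⟩ := hpq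
  have hα_ne (a : unitInterval) (x : X) : (γ x : E) - α a ∈ ({0}ᶜ : Set E) :=
    sub_ne_zero.2 fun h => hα a ⟨x, h⟩
  have hq_ne : -q ∈ ({0}ᶜ : Set E) :=
    neg_ne_zero.2 (norm_pos_iff.1 ((norm_nonneg _).trans_lt (hq (Classical.arbitrary X))))
  have norm_smul_lt (a : unitInterval) {v w : E} (hvw : ‖v‖ < ‖w‖) : ‖(a : ℝ) • v‖ < ‖w‖ := by
    rw [norm_smul, Real.norm_of_nonneg a.2.1]
    exact (mul_le_of_le_one_left (norm_nonneg v) a.2.2).trans_lt hvw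
  let γFrom (a : unitInterval) : C(X, ({0}ᶜ : Set E)) :=
    ⟨fun x => ⟨γ x - α a, hα_ne a x⟩, by fun_prop⟩
  have hstart : γ.Homotopic (γFrom 0) :=
    homotopic_of_forall_mem (H := fun y => γ y.2 - (y.1 : ℝ) • p) (by fun_prop)
      (fun y => sub_ne_zero.2 fun h => (norm_smul_lt y.1 (hp y.2)).ne (congrArg norm h).symm)
      (by simp) (by simp [γFrom])
  have hpath : (γFrom 0).Homotopic (γFrom 1) :=
    homotopic_of_forall_mem (H := fun y => γ y.2 - α y.1) (by fun_prop) (fun y => hα_ne y.1 y.2)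
      (fun _ => rfl) fun _ => rfl
  have hcontract : (γFrom 1).Homotopic (.const X ⟨-q, hq_ne⟩) :=
    homotopic_of_forall_mem (H := fun y => ((unitInterval.symm y.1 : ℝ)) • (γ y.2 : E) - q)
      (by fun_prop)
      (fun y => sub_ne_zero.2 fun h => (norm_smul_lt _ (hq y.2)).ne (congrArg norm h))
      (by simp [γFrom]) (by simp)
  exact ⟨_, hstart.trans (hpath.trans hcontract)⟩

theorem nullhomotopic_of_joinedIn_compl_range_cylinder {X : Type*} [TopologicalSpace X]
    [Nonempty X] {γ : C(X, Cylinder)} {p q : Cylinder} (hpq : JoinedIn (Set.range γ)ᶜ p q)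
    (hp : ∀ x, p.2 < (γ x).2) (hq : ∀ x, (γ x).2 < q.2) : γ.Nullhomotopic := by
  let e := cylinderHomeomorph
  obtain ⟨α, hα⟩ := hpq
  have hnull : ((e : C(Cylinder, ({0}ᶜ : Set ℂ))).comp γ).Nullhomotopic := by
    refine nullhomotopic_of_joinedIn_compl_range (p := e p) (q := e q)
      ⟨α.map (f := fun x => (e x : ℂ)) (by fun_prop), ?_⟩ (fun x => ?_) (fun x => ?_)
    · rintro t ⟨x, hx⟩
      exact hα t ⟨x, e.injective (Subtype.ext hx)⟩
    · simpa [e, norm_cylinderHomeomorph] using hp x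
    · simpa [e, norm_cylinderHomeomorph] using hq x
  convert hnull.comp_right (e.symm : C(({0}ᶜ : Set ℂ), Cylinder))
  ext x <;> simp

/-! ### Invariant circles bound the vertical motion -/

theorem isPathConnected_setOf_snd_mem {s : Set ℝ} (hs : IsPathConnected s) :
    IsPathConnected {x : Cylinder | x.2 ∈ s} := by
  simpa only [Set.univ_prod] using! (isPathConnected_univ (X := UnitAddCircle)).prod hs

/-- Otherwise the path-connected set `G '' {x | B ≤ x.2}`, which `γ` does not meet, would contain
points on both sides of `γ`. -/
theorem neg_lt_snd_of_image_range_eq {γ : C(UnitAddCircle, Cylinder)} (hγ : ¬ γ.Nullhomotopic)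
    {B D : ℝ} (hB : ∀ x, |(γ x).2| < B) {G : Cylinder → Cylinder} (hG : Continuous G)
    (hG_inj : Function.Injective G) (hD : ∀ x, |(G x).2 - x.2| ≤ D)
    (hinv : G '' Set.range γ = Set.range γ) {x : Cylinder} (hx : B ≤ x.2) : -B < (G x).2 := by
  by_contra! hle
  have hpath : IsPathConnected (G '' {y | y.2 ∈ Set.Ici B}) :=
    (isPathConnected_setOf_snd_mem ((convex_Ici B).isPathConnected Set.nonempty_Ici)).image hG
  have hsubset : G '' {y | y.2 ∈ Set.Ici B} ⊆ (Set.range γ)ᶜ := by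
    rintro _ ⟨y, hy, rfl⟩ hmem
    rw [← hinv, hG_inj.mem_set_image] at hmem
    obtain ⟨t, rfl⟩ := hmem
    exact (lt_of_abs_lt (hB t)).not_ge hy
  have hD_nonneg : 0 ≤ D := (abs_nonneg _).trans (hD x)
  let y : Cylinder := (0, B + D)
  have hy : B ≤ (G y).2 := by linarith [neg_le_of_abs_le (hD y), show y.2 = B + D from rfl]
  have hjoined := (hpath.joinedIn (G x) ⟨x, hx, rfl⟩ (G y)
    ⟨y, le_add_of_nonneg_right hD_nonneg, rfl⟩).mono hsubset
  exact hγ (nullhomotopic_of_joinedIn_compl_range_cylinder hjoined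
    (fun t => hle.trans_lt (neg_lt_of_abs_lt (hB t))) fun t => (lt_of_abs_lt (hB t)).trans_le hy)

theorem sub_lt_of_forall_int_le_add {B a b : ℝ} (h : ∀ l : ℤ, B ≤ a + l → -B < b + l) :
    a - b < 2 * B + 1 := by
  linarith [h ⌈B - a⌉ (by linarith [Int.le_ceil (B - a)]), Int.ceil_lt_add_one (B - a)]

theorem IsRotationalInvariantCircle.exists_abs_iterate_snd_sub_le {T : ℝ × ℝ → ℝ × ℝ}
    {C : Set Cylinder} (hC : IsRotationalInvariantCircle T C) (h : IsTwistHomeo T) :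
    ∃ K, ∀ n z, |(T^[n] z).2 - z.2| ≤ K := by
  obtain ⟨⟨γ, -, hγ, rfl⟩, hinv⟩ := hC
  obtain ⟨B, hB⟩ : ∃ B, ∀ x, |(γ x).2| < B := by
    obtain ⟨M, hM⟩ := (isCompact_range (f := fun x => |(γ x).2|) (by fun_prop)).bddAbove
    exact ⟨M + 1, fun x => lt_add_of_le_of_pos (hM ⟨x, rfl⟩) one_pos⟩
  refine ⟨2 * B + 1, fun n z => ?_⟩
  obtain ⟨D, hD⟩ := h.exists_abs_iterate_snd_sub_le n
  let e := (isHomeomorph_iterate h.isHomeomorph_inducedCylMap n).homeomorph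
  have he (w) : e (cylProj w) = cylProj (T^[n] w) := ((h.semiconj_cylProj_iterate n).eq w).symm
  have heD (x) : |(e x).2 - x.2| ≤ D := by
    obtain ⟨w, rfl⟩ := isOpenQuotientMap_cylProj.surjective x
    exact he w ▸ hD w
  have hsymmD (x) : |(e.symm x).2 - x.2| ≤ D := by
    simpa only [e.apply_symm_apply, abs_sub_comm] using heD (e.symm x)
  have he_inv : e '' Set.range γ = Set.range γ := by
    change (inducedCylMap T)^[n] '' Set.range γ = Set.range γ
    rw [Set.image_iterate_eq, Function.iterate_fixed hinv]
  have hsymm_inv : e.symm '' Set.range γ = Set.range γ := by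
    conv_lhs => rw [e.image_symm, ← he_inv, e.injective.preimage_image]
  have hshift (l : ℤ) :
      e (cylProj (z + (0, (l : ℝ)))) = cylProj (T^[n] z + ((n : ℝ) * l, (l : ℝ))) := by
    simpa only [Int.cast_zero, zero_add, he] using congrArg cylProj (h.iterate_add_int n z 0 l)
  refine abs_sub_le_iff.2 ⟨(sub_lt_of_forall_int_le_add fun l hl => ?_).le,
    (sub_lt_of_forall_int_le_add fun l hl => ?_).le⟩
  · have hlt := neg_lt_snd_of_image_range_eq hγ hB e.symm.continuous e.symm.injective hsymmD
      hsymm_inv (x := cylProj (T^[n] z + ((n : ℝ) * l, (l : ℝ)))) hl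
    rwa [← hshift, e.symm_apply_apply] at hlt
  · have hlt := neg_lt_snd_of_image_range_eq hγ hB e.continuous e.injective heD
      he_inv (x := cylProj (z + ((0 : ℝ), (l : ℝ)))) hl
    rwa [hshift] at hlt

theorem HasRotationVector.eq_zero_of_abs_iterate_snd_sub_le {T : ℝ × ℝ → ℝ × ℝ} {z : ℝ × ℝ}
    {a : EReal} {ω K : ℝ} (hz : HasRotationVector T z (a, (ω : EReal)))
    (hK : ∀ n, |(T^[n] z).2 - z.2| ≤ K) : ω = 0 :=
  tendsto_nhds_unique (EReal.tendsto_coe.1 ((continuous_snd.tendsto _).comp hz)) <|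
    tendsto_bdd_div_atTop_nhds_zero (Eventually.of_forall fun n => neg_le_of_abs_le (hK n))
      (Eventually.of_forall fun n => le_of_abs_le (hK n)) tendsto_natCast_atTop_atTop

theorem mainTheorem1_general {T : ℝ × ℝ → ℝ × ℝ} (h : IsTwistHomeo T) {μ : Measure Cylinder}
    [IsLocallyFiniteMeasure μ] [μ.IsOpenPosMeasure] (hinv : MeasurePreserving (inducedCylMap T) μ μ)
    (hflux : μ (inducedCylMap T '' {x | x.2 < 0} \ {x | x.2 < 0}) =
      μ ({x | x.2 < 0} \ inducedCylMap T '' {x | x.2 < 0})) (k : ℤ) (hk : k ≠ 0) :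
    (∃ N : ℕ, 0 < N ∧ ∃ O : Set Torus, IsPeriodicOrbit (inducedTorusMap T) O ∧
        HasVerticalRotationNumber T O ((k : ℝ) / (N : ℝ))) ↔
      ¬ ∃ C : Set Cylinder, IsRotationalInvariantCircle T C := by
  constructor
  · rintro ⟨N, hN, O, ⟨x, -, rfl⟩, hrot⟩ ⟨C, hC⟩
    obtain ⟨K, hK⟩ := hC.exists_abs_iterate_snd_sub_le h
    have hω : (k : ℝ) / N ≠ 0 := div_ne_zero (Int.cast_ne_zero.2 hk) (Nat.cast_ne_zero.2 hN.ne')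
    rcases hrot _ ⟨0, (torusProj_circleRep x).symm⟩ with hz | hz <;>
      exact hω (hz.eq_zero_of_abs_iterate_snd_sub_le fun n => hK n _)
  · intro hno
    rcases h.exists_invariant_graph_or_exists_iterate_eq_add (h.isDriftFree hinv hflux) k with
      ⟨u, hu, hper, hgraph⟩ | ⟨M, s, z, hz⟩
    · exact absurd (h.exists_isRotationalInvariantCircle_of_graph hu hper hgraph) hno
    · exact ⟨M + 1, M.succ_pos, h.exists_isPeriodicOrbit_of_iterate_eq_add M.succ_ne_zero hk hz⟩

end

theorem mainTheorem1 (T : ℝ × ℝ → ℝ × ℝ) (hT : IsTQ T)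
    (μ : Measure Cylinder) [IsLocallyFiniteMeasure μ] [μ.IsOpenPosMeasure]
    (hac : μ ≪ (volume : Measure Cylinder))
    (hexact : IsMuExact μ (inducedCylMap T)) :
    ∀ k : ℤ, k ≠ 0 →
      ((∃ N : ℕ, 0 < N ∧ ∃ O : Set Torus, IsPeriodicOrbit (inducedTorusMap T) O ∧
          HasVerticalRotationNumber T O ((k : ℝ) / (N : ℝ))) ↔
        ¬ ∃ C : Set Cylinder, IsRotationalInvariantCircle T C) :=
  mainTheorem1_general hT.isTwistHomeo hexact.invariant hexact.flux_lowerHalf
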